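/- The following is a theorem of ZF (no form of the Axiom of Choice is used); equivalently, it holds in every model of ZF. Let $X$ be a CF set, that is, $X$ is infinite (not equipotent with any natural number) and Cohen-finite: the set $\mathrm{Fin}(X)$ of all finite subsets of $X$ is Dedekind-finite, i.e. every injective function $\mathrm{Fin}(X)\to\mathrm{Fin}(X)$ is surjective. Let $$\ell^2(X)=\Big\{\eta\colon X\to\mathbb{C} : \sum_{x\in X}|\eta(x)|^2<\infty\Big\},\qquad \|\eta\|=\Big(\sum_{x\in X}|\eta(x)|^2\Big)^{1/2},$$ where the sum of a nonnegative function over $X$ is the supremum of its sums over finite subsets of $X$. Let $T\colon \ell^2(X)\to\ell^2(X)$ be a linear operator that is compact, in the sense that for every norm-bounded set $A\subseteq\ell^2(X)$ the image $T(A)$ is totally bounded (for every $\varepsilon>0$ it is covered by finitely many open balls of radius $\varepsilon$). Then $T$ has finite rank: its range is spanned by a finite set of vectors. -/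

import Mathlib

/-! ## Models of ZF

Choice is available in Lean's own logic, so a theorem of ZF is stated here as a statement about all
models of the first-order theory ZF. Every definition below speaks about the elements of a model
only: sets, functions, real numbers, vectors and operators are elements of the model. -/

namespace ChoiceFree

/-- The relation symbols of the language of set theory: one binary symbol. -/
inductive SetRel : ℕ → Type
  | mem : SetRel 2

/-- The first-order language of set theory. -/
def setLang : FirstOrder.Language.{0, 0} := ⟨fun _ => Empty, SetRel⟩

section Basic

variable {M : Type*} [setLang.Structure M]

/-- The membership relation of the structure `M`. -/
def Mem (x y : M) : Prop :=
  FirstOrder.Language.Structure.RelMap (L := setLang) SetRel.mem ![x, y]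

infix:50 " ∈ₘ " => Mem

/-- `e` is the empty set. -/
def IsEmptySet (e : M) : Prop := ∀ z : M, ¬ z ∈ₘ e

/-- `b = {x, y}`. -/
def IsUnorderedPair (b x y : M) : Prop := ∀ z : M, z ∈ₘ b ↔ z = x ∨ z = y

/-- `p` is the Kuratowski pair `(x, y) = {{x}, {x, y}}`. -/
def IsPair (p x y : M) : Prop :=
  ∀ b : M, b ∈ₘ p ↔ IsUnorderedPair b x x ∨ IsUnorderedPair b x y

/-- `b = a ∪ {x}`. -/
def IsInsert (b x a : M) : Prop := ∀ z : M, z ∈ₘ b ↔ z ∈ₘ a ∨ z = x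

/-- `a ⊆ b`. -/
def Sub (a b : M) : Prop := ∀ z : M, z ∈ₘ a → z ∈ₘ b

/-- `I` contains `∅` and is closed under `x ↦ x ∪ {x}`. -/
def IsInductive (I : M) : Prop :=
  (∃ e : M, IsEmptySet e ∧ e ∈ₘ I) ∧
    ∀ x : M, x ∈ₘ I → ∃ s : M, IsInsert s x x ∧ s ∈ₘ I

end Basic

/-- `M` is a model of Zermelo-Fraenkel set theory, without any form of choice. In the two schemas
`φ` runs over all first-order formulas of the language of set theory, the variable `0` (and, for
replacement, `1`) is the distinguished one, and `v` gives the values of the parameters. -/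
class ModelZF (M : Type*) [setLang.Structure M] : Prop where
  extensionality : ∀ a b : M, (∀ z : M, z ∈ₘ a ↔ z ∈ₘ b) → a = b
  foundation : ∀ a : M, (∃ x : M, x ∈ₘ a) → ∃ x : M, x ∈ₘ a ∧ ∀ y : M, y ∈ₘ x → ¬ y ∈ₘ a
  pairing : ∀ x y : M, ∃ b : M, IsUnorderedPair b x y
  union : ∀ a : M, ∃ b : M, ∀ z : M, z ∈ₘ b ↔ ∃ y : M, y ∈ₘ a ∧ z ∈ₘ y
  powerset : ∀ a : M, ∃ b : M, ∀ z : M, z ∈ₘ b ↔ Sub z a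
  infinity : ∃ I : M, IsInductive I
  separation : ∀ (φ : setLang.Formula ℕ) (v : ℕ → M) (a : M),
    ∃ b : M, ∀ x : M, x ∈ₘ b ↔ x ∈ₘ a ∧ φ.Realize (Function.update v 0 x)
  replacement : ∀ (φ : setLang.Formula ℕ) (v : ℕ → M) (a : M),
    (∀ x : M, x ∈ₘ a → ∃! y : M, φ.Realize (Function.update (Function.update v 0 x) 1 y)) →
    ∃ b : M, ∀ y : M, y ∈ₘ b ↔
      ∃ x : M, x ∈ₘ a ∧ φ.Realize (Function.update (Function.update v 0 x) 1 y)

noncomputable section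

variable {M : Type*} [setLang.Structure M]

/-! ## Functions and finiteness inside a model -/

/-- The elements of `M` that satisfy `P`. -/
abbrev Elt (P : M → Prop) : Type _ := {x : M // P x}

/-- The class of the elements of the set `a` of `M`. -/
def In (a : M) : M → Prop := fun x => x ∈ₘ a

/-- The ordered pair `(x, y)` belongs to `f`. -/
def PairMem (x y f : M) : Prop := ∃ p : M, IsPair p x y ∧ p ∈ₘ f

/-- `f` is, in the sense of `M`, a function from `P` to `Q`: a set of ordered pairs with exactly
one pair `(x, y)`, where `y` satisfies `Q`, for every `x` that satisfies `P`. -/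
def IsFunction (P Q : M → Prop) (f : M) : Prop :=
  (∀ p : M, p ∈ₘ f → ∃ x y : M, P x ∧ Q y ∧ IsPair p x y) ∧
    ∀ x : M, P x → ∃! y : M, Q y ∧ PairMem x y f

/-- The functions from `P` to `Q` that are elements of `M`. -/
def Fn (P Q : M → Prop) : Type _ := {f : M // IsFunction P Q f}

/-- The value of a function of `M`. -/
def Fn.apply {P Q : M → Prop} (f : Fn P Q) (x : Elt P) : Elt Q :=
  ⟨(f.2.2 x.1 x.2).choose, (f.2.2 x.1 x.2).choose_spec.1.1⟩

instance {P Q : M → Prop} : CoeFun (Fn P Q) (fun _ => Elt P → Elt Q) := ⟨Fn.apply⟩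

/-- `n` is a natural number (a finite von Neumann ordinal) of `M`. -/
def IsNat (n : M) : Prop := ∀ I : M, IsInductive I → n ∈ₘ I

/-- `a` is finite in `M`: equipotent with a natural number of `M`. -/
def IsFinite (a : M) : Prop :=
  ∃ n : M, IsNat n ∧ ∃ f : Fn (In n) (In a), Function.Bijective f

/-- `F` belongs to `Fin(X)`, the set of finite subsets of `X`. -/
def IsFinSubset (X : M) : M → Prop := fun F => Sub F X ∧ IsFinite F

/-- `P` is Dedekind-finite in `M`: every injective function of `M` from `P` to `P` is surjective. -/
def IsDedekindFinite (P : M → Prop) : Prop :=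
  ∀ f : Fn P P, Function.Injective f → Function.Surjective f

/-- `X` is Cohen-finite in `M`: the set `Fin(X)` is Dedekind-finite. -/
def IsCohenFinite (X : M) : Prop := IsDedekindFinite (IsFinSubset X)

/-- `X` is CF in `M`: infinite and Cohen-finite. -/
def IsCF (X : M) : Prop := ¬ IsFinite X ∧ IsCohenFinite X

/-! ## Real and complex numbers of a model -/

/-- `R` is the field of real numbers of `M`: an ordered field whose operations and order are
elements of `M`, in which every nonempty set of `M` that is bounded above has a supremum. As usual,
this determines `R` in `M` up to a unique isomorphism. -/
structure IsReals (R : M) [Field (Elt (In R))] [LinearOrder (Elt (In R))]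
    [IsStrictOrderedRing (Elt (In R))] : Prop where
  add_mem : ∃ g : M, ∀ p : M, p ∈ₘ g ↔
    ∃ x y : Elt (In R), ∃ q : M, IsPair q x.1 y.1 ∧ IsPair p q (x + y).1
  mul_mem : ∃ g : M, ∀ p : M, p ∈ₘ g ↔
    ∃ x y : Elt (In R), ∃ q : M, IsPair q x.1 y.1 ∧ IsPair p q (x * y).1
  le_mem : ∃ g : M, ∀ p : M, p ∈ₘ g ↔ ∃ x y : Elt (In R), x ≤ y ∧ IsPair p x.1 y.1
  complete : ∀ A : M, {x : Elt (In R) | x.1 ∈ₘ A}.Nonempty →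
    BddAbove {x : Elt (In R) | x.1 ∈ₘ A} → ∃ s, IsLUB {x : Elt (In R) | x.1 ∈ₘ A} s

/-- `z` is a complex number: an ordered pair of elements of `R`. -/
def IsComplex (R : M) : M → Prop := fun z => ∃ a b : M, a ∈ₘ R ∧ b ∈ₘ R ∧ IsPair z a b

/-- The ring `R[i]` with `i² = -1`. -/
abbrev Cx (R : M) [Field (Elt (In R))] : Type _ := QuadraticAlgebra (Elt (In R)) (-1) 0

/-- The pair `z = (a, b)` as the complex number `a + b i`. -/
def toCx {R : M} [Field (Elt (In R))] (z : Elt (IsComplex R)) : Cx R :=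
  ⟨⟨z.2.choose, z.2.choose_spec.choose_spec.1⟩,
    ⟨z.2.choose_spec.choose, z.2.choose_spec.choose_spec.2.1⟩⟩

/-! ## The Hilbert space of square-summable functions -/

section EllTwo

variable (X R : M) [Field (Elt (In R))]

/-- The functions from `X` to the complex numbers. -/
abbrev CFn : Type _ := Fn (In X) (IsComplex R)

variable {X R}

/-- The value `ξ(x)`. -/
def CFn.val (ξ : CFn X R) (x : Elt (In X)) : Cx R := toCx (ξ x)

/-- `S` is the function that sends every finite `F ⊆ X` to `∑ x ∈ F, w x`. -/
def IsFinSums (w : Elt (In X) → Elt (In R)) (S : Fn (IsFinSubset X) (In R)) : Prop :=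
  (∀ F : Elt (IsFinSubset X), IsEmptySet F.1 → S F = 0) ∧
    ∀ (F G : Elt (IsFinSubset X)) (x : Elt (In X)),
      ¬ x.1 ∈ₘ F.1 → IsInsert G.1 x.1 F.1 → S G = S F + w x

variable [LinearOrder (Elt (In R))]

/-- `∑ x ∈ X, w x ≤ b`: the sum is the supremum of the sums over the finite subsets of `X`. -/
def SumLE (w : Elt (In X) → Elt (In R)) (b : Elt (In R)) : Prop :=
  ∃ S : Fn (IsFinSubset X) (In R), IsFinSums w S ∧ ∀ F, S F ≤ b

/-- `|z|²` for a complex number `z = a + b i`. -/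
def absSq (z : Cx R) : Elt (In R) := z.re ^ 2 + z.im ^ 2

variable (X R) in
/-- `ξ` belongs to `ℓ²(X)`: it is a function from `X` to the complex numbers, and
`∑ x ∈ X, |ξ(x)|² < ∞`. -/
def IsL2 : M → Prop := fun ξ =>
  ∃ h : IsFunction (In X) (IsComplex R) ξ, ∃ b : Elt (In R),
    SumLE (fun x => absSq (CFn.val ⟨ξ, h⟩ x)) b

variable (X R) in
/-- The space `ℓ²(X)` of `M`. -/
abbrev L2 : Type _ := Elt (IsL2 X R)

/-- The coordinate `ξ(x)` of a vector. -/
def L2.val (ξ : L2 X R) (x : Elt (In X)) : Cx R := CFn.val ⟨ξ.1, ξ.2.choose⟩ x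

/-- `‖ξ‖ ≤ r`. -/
def NormLE (ξ : L2 X R) (r : Elt (In R)) : Prop :=
  0 ≤ r ∧ SumLE (fun x => absSq (ξ.val x)) (r ^ 2)

/-- `‖ξ - η‖ < r`. -/
def DistLT (ξ η : L2 X R) (r : Elt (In R)) : Prop :=
  ∃ s, 0 ≤ s ∧ s < r ∧ SumLE (fun x => absSq (ξ.val x - η.val x)) (s ^ 2)

/-- `ζ = ξ + η`. -/
def IsAdd (ζ ξ η : L2 X R) : Prop := ∀ x, ζ.val x = ξ.val x + η.val x

/-- `ζ = c ξ`. -/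
def IsSMul (ζ : L2 X R) (c : Cx R) (ξ : L2 X R) : Prop := ∀ x, ζ.val x = c * ξ.val x

variable (X R) in
/-- The set `W` of `M` is a linear subspace of `ℓ²(X)`. -/
def IsSubspace (W : M) : Prop :=
  (∀ ξ : M, ξ ∈ₘ W → IsL2 X R ξ) ∧
  (∀ ζ : L2 X R, (∀ x, ζ.val x = 0) → ζ.1 ∈ₘ W) ∧
  (∀ ζ ξ η : L2 X R, IsAdd ζ ξ η → ξ.1 ∈ₘ W → η.1 ∈ₘ W → ζ.1 ∈ₘ W) ∧
  ∀ (ζ : L2 X R) (c : Cx R) (ξ : L2 X R), IsSMul ζ c ξ → ξ.1 ∈ₘ W → ζ.1 ∈ₘ W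

/-- `B` is norm-bounded in `ℓ²(X)`. -/
def IsBoundedSet (B : Set (L2 X R)) : Prop := ∃ r, ∀ ξ ∈ B, NormLE ξ r

/-- `B` is totally bounded in `M`: for every `r > 0` it is covered by the open balls of radius `r`
around the elements of a finite set of `M`. -/
def IsTotallyBounded (B : Set (L2 X R)) : Prop :=
  ∀ r : Elt (In R), 0 < r → ∃ C : M, IsFinite C ∧ (∀ η : M, η ∈ₘ C → IsL2 X R η) ∧
    ∀ ξ ∈ B, ∃ η : L2 X R, η.1 ∈ₘ C ∧ DistLT ξ η r

/-- The function `T` of `M` from `ℓ²(X)` to itself is linear. -/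
def IsLinearOp (T : Fn (IsL2 X R) (IsL2 X R)) : Prop :=
  (∀ ζ ξ η : L2 X R, IsAdd ζ ξ η → IsAdd (T ζ) (T ξ) (T η)) ∧
  ∀ (ζ : L2 X R) (c : Cx R) (ξ : L2 X R), IsSMul ζ c ξ → IsSMul (T ζ) c (T ξ)

/-- `T` is a compact operator: it is linear, and for every set `A` of `M` that is a bounded subset
of `ℓ²(X)`, the image of `A` under `T` is totally bounded. -/
def IsCompactOp (T : Fn (IsL2 X R) (IsL2 X R)) : Prop :=
  IsLinearOp T ∧ ∀ A : M, (∀ ξ : M, ξ ∈ₘ A → IsL2 X R ξ) →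
    IsBoundedSet {ξ : L2 X R | ξ.1 ∈ₘ A} →
    IsTotallyBounded (T.apply '' {ξ : L2 X R | ξ.1 ∈ₘ A})

/-- `T` has finite rank: its range is finite-dimensional, that is, some finite set `F` of `M`
consists of vectors in the range of `T`, and every linear subspace that contains `F` contains the
range. -/
def HasFiniteRank (T : Fn (IsL2 X R) (IsL2 X R)) : Prop :=
  ∃ F : M, IsFinite F ∧ (∀ η : M, η ∈ₘ F → ∃ ξ : L2 X R, (T ξ).1 = η) ∧
    ∀ W : M, IsSubspace X R W → (∀ η : M, η ∈ₘ F → η ∈ₘ W) → ∀ ξ : L2 X R, (T ξ).1 ∈ₘ W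

end EllTwo

end

end ChoiceFree

/-! A nonempty set of finite subsets of `X` that is a chain under inclusion has a greatest element
if `X` is Cohen-finite (`IsCohenFinite.exists_greatest_of_chain`). Every nonempty subset of such a
chain has a least element, so without a greatest element every member has an immediate successor.
The successor map, extended by the identity to the rest of `Fin(X)`, would be injective and miss the
least member. Hence an increasing family of finite subsets of `X` indexed by the positive reals has
a finite union (`IsCohenFinite.exists_bound`).

Applied to the sets `{x : |ξ(x)|² ≥ 1/r}`, this shows that every vector of `ℓ²(X)` has finite
support. For compact `T`, consider the set of points `y` at which some `ξ` with `‖ξ‖ ≤ r` has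
`|(Tξ)(y)| ≥ 1/r`. The image of the ball of radius `r` is covered by finitely many balls of radius
`1/r`, so these `y` lie in the union of the finite supports of the centres. The sets increase with
`r`, so their union is finite, and it supports the whole range of `T`
(`IsCompactOp.finite_support`). Gaussian elimination on a finite set of coordinates then gives
finitely many generators inside the range (`IsLinearOp.exists_generators`).

All of this happens inside `M`, where only sets given by formulas exist. The classes `Definable` and
`DefinableFun` let instance search produce the formulas for separation, replacement and induction.
-/

namespace ChoiceFree

/-! ## First-order definability with parameters -/

section Definability

open FirstOrder FirstOrder.Language

universe u
variable {M : Type u} [setLang.Structure M]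

/-- `P` is definable in `M` by a formula with parameters; `v 0, v 1, …` are the free variables. -/
class Definable (P : (ℕ → M) → Prop) : Prop where
  out : ∃ φ : setLang.Formula (ℕ ⊕ M), ∀ v, P v ↔ φ.Realize (Sum.elim v id)

/-- The graph of `f` is definable in `M` with parameters. -/
class DefinableFun (f : (ℕ → M) → M) : Prop where
  out : Definable (fun v => v 0 = f (fun n => v (n + 1)))

theorem Definable.congr {P Q : (ℕ → M) → Prop} (hP : Definable P) (h : ∀ v, P v ↔ Q v) :
    Definable Q := by
  obtain rfl : P = Q := funext fun v => propext (h v)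
  exact hP

instance Definable.and {P Q : (ℕ → M) → Prop} [hP : Definable P] [hQ : Definable Q] :
    Definable (fun v => P v ∧ Q v) := by
  obtain ⟨φ, hφ⟩ := hP.out
  obtain ⟨ψ, hψ⟩ := hQ.out
  exact ⟨φ ⊓ ψ, fun v => by rw [Formula.realize_inf, hφ, hψ]⟩

instance Definable.or {P Q : (ℕ → M) → Prop} [hP : Definable P] [hQ : Definable Q] :
    Definable (fun v => P v ∨ Q v) := by
  obtain ⟨φ, hφ⟩ := hP.out
  obtain ⟨ψ, hψ⟩ := hQ.out
  exact ⟨φ ⊔ ψ, fun v => by rw [Formula.realize_sup, hφ, hψ]⟩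

instance Definable.imp {P Q : (ℕ → M) → Prop} [hP : Definable P] [hQ : Definable Q] :
    Definable (fun v => P v → Q v) := by
  obtain ⟨φ, hφ⟩ := hP.out
  obtain ⟨ψ, hψ⟩ := hQ.out
  exact ⟨φ.imp ψ, fun v => by rw [Formula.realize_imp, hφ, hψ]⟩

instance Definable.iff {P Q : (ℕ → M) → Prop} [hP : Definable P] [hQ : Definable Q] :
    Definable (fun v => P v ↔ Q v) :=
  (inferInstance : Definable fun v => (P v → Q v) ∧ (Q v → P v)).congr fun _ => iff_def.symm

/-- A proposition without free variables is decided outside `M`, so `⊤` or `⊥` defines it. With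
`Definable.imp` this also covers negation, as `P → False`. -/
instance Definable.const {p : Prop} : Definable (fun _ : ℕ → M => p) := by
  by_cases h : p
  · exact ⟨⊤, fun v => by simp [h]⟩
  · exact ⟨⊥, fun v => by simp [h]⟩

theorem Definable.rename {P : (ℕ → M) → Prop} (hP : Definable P) (σ : ℕ → ℕ) :
    Definable (fun v => P (fun n => v (σ n))) := by
  obtain ⟨φ, hφ⟩ := hP.out
  refine ⟨φ.relabel (Sum.map σ id), fun v => ?_⟩
  rw [Formula.realize_relabel, hφ]
  apply iff_of_eq
  congr 1
  ext x
  cases x <;> rfl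

/-- Variables follow the de Bruijn convention: under a quantifier the bound variable is `v 0` and
all others move up by one. Instance search can thus descend through a statement without naming
variables. -/
instance Definable.exists {P : (ℕ → M) → M → Prop}
    [hP : Definable fun v => P (fun n => v (n + 1)) (v 0)] : Definable (fun v => ∃ y, P v y) := by
  obtain ⟨φ, hφ⟩ := hP.out
  let g : ℕ ⊕ M → (ℕ ⊕ M) ⊕ Unit :=
    Sum.elim (fun n => Nat.casesOn n (Sum.inr ()) fun k => Sum.inl (Sum.inl k))
      fun m => Sum.inl (Sum.inr m)
  refine ⟨(φ.relabel g).iExs Unit, fun v => ?_⟩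
  rw [Formula.realize_iExs]
  have key : ∀ i : Unit → M, P v (i ()) ↔
      (φ.relabel g).Realize (Sum.elim (Sum.elim v id) i) := by
    intro i
    have := hφ (fun n => Nat.casesOn n (i ()) v)
    rw [Formula.realize_relabel]
    refine Iff.trans this (iff_of_eq ?_)
    congr 1
    ext x
    rcases x with (_ | n) | m <;> rfl
  exact ⟨fun ⟨y, hy⟩ => ⟨fun _ => y, (key _).1 hy⟩, fun ⟨i, hi⟩ => ⟨i (), (key _).2 hi⟩⟩

instance Definable.forall {P : (ℕ → M) → M → Prop}
    [hP : Definable fun v => P (fun n => v (n + 1)) (v 0)] : Definable (fun v => ∀ y, P v y) :=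
  (inferInstance : Definable fun v => ¬ ∃ y, ¬ P v y).congr fun _ => not_exists_not

theorem definable_var_eq (i j : ℕ) : Definable (fun v : ℕ → M => v i = v j) :=
  ⟨(Term.var (Sum.inl i)).equal (Term.var (Sum.inl j)), fun v => by
    simp [Formula.realize_equal]⟩

theorem definable_var_eq_const (i : ℕ) (c : M) : Definable (fun v : ℕ → M => v i = c) :=
  ⟨(Term.var (Sum.inl i)).equal (Term.var (Sum.inr c)), fun v => by
    simp [Formula.realize_equal]⟩

theorem definable_var_mem (i j : ℕ) : Definable (fun v : ℕ → M => v i ∈ₘ v j) :=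
  ⟨Relations.formula₂ (L := setLang) SetRel.mem (Term.var (Sum.inl i)) (Term.var (Sum.inl j)),
    fun v => (Formula.realize_rel₂ (L := setLang) (R := SetRel.mem) (t₁ := Term.var (Sum.inl i))
      (t₂ := Term.var (Sum.inl j)) (v := Sum.elim v id)).symm⟩

instance DefinableFun.var (i : ℕ) : DefinableFun (fun v : ℕ → M => v i) := ⟨definable_var_eq _ _⟩

instance DefinableFun.const (c : M) : DefinableFun (fun _ : ℕ → M => c) :=
  ⟨definable_var_eq_const _ _⟩

/-- Substitution of a definable function for the variable `0`. -/
theorem Definable.subst {P : (ℕ → M) → M → Prop} {f : (ℕ → M) → M}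
    (hP : Definable fun v => P (fun n => v (n + 1)) (v 0)) (hf : DefinableFun f) :
    Definable (fun v => P v (f v)) := by
  have := hf.out
  exact (inferInstance : Definable fun v => ∃ y, y = f v ∧ P v y).congr fun v => by simp

theorem DefinableFun.rename {f : (ℕ → M) → M} (hf : DefinableFun f) (σ : ℕ → ℕ) :
    DefinableFun (fun v => f (fun n => v (σ n))) :=
  ⟨(hf.out.rename (fun n => Nat.casesOn n 0 fun k => σ k + 1)).congr fun _ => Iff.rfl⟩

theorem Definable.comp₁ {Q : M → Prop} (hQ : Definable fun v => Q (v 0)) {f : (ℕ → M) → M}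
    (hf : DefinableFun f) : Definable (fun v => Q (f v)) :=
  Definable.subst (P := fun _ y => Q y) hQ hf

/-- It suffices to know that a relation between variables is definable; terms are substituted one at
a time. Each substitution puts its new variable at index `0`, so the order of the arguments is
reversed and the final renaming restores it. -/
theorem Definable.comp₂ {Q : M → M → Prop} (hQ : Definable fun v => Q (v 0) (v 1))
    {f g : (ℕ → M) → M} (hf : DefinableFun f) (hg : DefinableFun g) :
    Definable (fun v => Q (f v) (g v)) := by
  refine Definable.subst (P := fun v y => Q y (g v)) ?_ hf
  refine Definable.subst (P := fun v y => Q (v 0) y) ?_ (hg.rename (· + 1))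
  exact (hQ.rename (fun n => Nat.casesOn n 1 fun _ => 0)).congr fun _ => Iff.rfl

theorem Definable.comp₃ {Q : M → M → M → Prop} (hQ : Definable fun v => Q (v 0) (v 1) (v 2))
    {f g h : (ℕ → M) → M} (hf : DefinableFun f) (hg : DefinableFun g) (hh : DefinableFun h) :
    Definable (fun v => Q (f v) (g v) (h v)) := by
  refine Definable.subst (P := fun v y => Q y (g v) (h v)) ?_ hf
  refine Definable.subst (P := fun v y => Q (v 0) y (h fun n => v (n + 1))) ?_ (hg.rename (· + 1))
  refine Definable.subst (P := fun v y => Q (v 1) (v 0) y) ?_ (hh.rename (· + 2))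
  exact (hQ.rename (fun n => Nat.casesOn n 2 fun n => Nat.casesOn n 1 fun _ => 0)).congr
    fun _ => Iff.rfl

theorem DefinableFun.comp₁ {q : M → M} (hq : DefinableFun fun v => q (v 0)) {f : (ℕ → M) → M}
    (hf : DefinableFun f) : DefinableFun (fun v => q (f v)) := by
  refine ⟨Definable.subst (P := fun v y => v 0 = q y) ?_ (hf.rename (· + 1))⟩
  exact (hq.out.rename (fun n => Nat.casesOn n 1 fun _ => 0)).congr fun _ => Iff.rfl

theorem DefinableFun.comp₂ {q : M → M → M} (hq : DefinableFun fun v => q (v 0) (v 1))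
    {f g : (ℕ → M) → M} (hf : DefinableFun f) (hg : DefinableFun g) :
    DefinableFun (fun v => q (f v) (g v)) := by
  refine ⟨Definable.subst (P := fun v y => v 0 = q y (g fun n => v (n + 1))) ?_
    (hf.rename (· + 1))⟩
  refine Definable.subst (P := fun v y => v 1 = q (v 0) y) ?_ (hg.rename (· + 2))
  exact (hq.out.rename (fun n => Nat.casesOn n 2 fun n => Nat.casesOn n 1 fun _ => 0)).congr
    fun _ => Iff.rfl

instance Definable.mem {f g : (ℕ → M) → M} [hf : DefinableFun f] [hg : DefinableFun g] :
    Definable (fun v => f v ∈ₘ g v) :=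
  Definable.comp₂ (definable_var_mem 0 1) hf hg

instance Definable.eq {f g : (ℕ → M) → M} [hf : DefinableFun f] [hg : DefinableFun g] :
    Definable (fun v => f v = g v) :=
  Definable.comp₂ (definable_var_eq 0 1) hf hg

instance Definable.existsUnique {P : (ℕ → M) → M → Prop}
    [hP : Definable fun v => P (fun n => v (n + 1)) (v 0)] : Definable (fun v => ∃! y, P v y) := by
  have h2 : Definable fun v => P (fun n => v (n + 2)) (v 0) :=
    (hP.rename (fun n => Nat.casesOn n 0 fun k => k + 2)).congr fun _ => Iff.rfl
  exact (inferInstance : Definable fun v => ∃ y, P v y ∧ ∀ z, P v z → z = y).congr fun _ => Iff.rfl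

instance Definable.sub {f g : (ℕ → M) → M} [hf : DefinableFun f] [hg : DefinableFun g] :
    Definable (fun v => Sub (f v) (g v)) :=
  Definable.comp₂ (Q := Sub) (by unfold Sub; infer_instance) hf hg

instance Definable.isEmptySet {f : (ℕ → M) → M} [hf : DefinableFun f] :
    Definable (fun v => IsEmptySet (f v)) :=
  Definable.comp₁ (Q := IsEmptySet) (by unfold IsEmptySet; infer_instance) hf

instance Definable.isUnorderedPair {f g h : (ℕ → M) → M} [hf : DefinableFun f]
    [hg : DefinableFun g] [hh : DefinableFun h] :
    Definable (fun v => IsUnorderedPair (f v) (g v) (h v)) :=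
  Definable.comp₃ (Q := IsUnorderedPair) (by unfold IsUnorderedPair; infer_instance) hf hg hh

instance Definable.isPair {f g h : (ℕ → M) → M} [hf : DefinableFun f]
    [hg : DefinableFun g] [hh : DefinableFun h] :
    Definable (fun v => IsPair (f v) (g v) (h v)) :=
  Definable.comp₃ (Q := IsPair) (by unfold IsPair; infer_instance) hf hg hh

instance Definable.isInsert {f g h : (ℕ → M) → M} [hf : DefinableFun f]
    [hg : DefinableFun g] [hh : DefinableFun h] :
    Definable (fun v => IsInsert (f v) (g v) (h v)) :=
  Definable.comp₃ (Q := IsInsert) (by unfold IsInsert; infer_instance) hf hg hh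

instance Definable.isInductive {f : (ℕ → M) → M} [hf : DefinableFun f] :
    Definable (fun v => IsInductive (f v)) :=
  Definable.comp₁ (Q := IsInductive) (by unfold IsInductive; infer_instance) hf

instance Definable.isNat {f : (ℕ → M) → M} [hf : DefinableFun f] :
    Definable (fun v => IsNat (f v)) :=
  Definable.comp₁ (Q := IsNat) (by unfold IsNat; infer_instance) hf

-- The schemas of `ModelZF` take formulas without constants from `M`. A formula has finitely many
-- free variables and constants, so apart from the variables `0` and `1` these can be renumbered
-- from `2` on, with their values stored in a valuation.
open Classical in
theorem exists_nat_formula (φ : setLang.Formula (ℕ ⊕ M)) (w : ℕ → M) :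
    ∃ (ψ : setLang.Formula ℕ) (u : ℕ → M), ∀ x y,
      ψ.Realize (Function.update (Function.update u 0 x) 1 y) ↔
        φ.Realize (Sum.elim (Function.update (Function.update w 0 x) 1 y) id) := by
  let s := BoundedFormula.freeVarFinset φ
  let f : s → ℕ := fun a => if a.1 = Sum.inl 0 then 0 else if a.1 = Sum.inl 1 then 1 else
    (s.equivFin a : ℕ) + 2
  -- At `n = 0, 1` the truncated `n - 2` yields an irrelevant value: both updates overwrite it.
  let u : ℕ → M := fun n => if h : n - 2 < s.card then
    Sum.elim w id (s.equivFin.symm ⟨n - 2, h⟩).1 else w 0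
  refine ⟨BoundedFormula.restrictFreeVar φ f, u, fun x y => ?_⟩
  refine BoundedFormula.realize_restrictFreeVar
    (Sum.elim (Function.update (Function.update w 0 x) 1 y) id) fun a => ?_
  by_cases h0 : a.1 = Sum.inl 0
  · simp [f, h0]
  by_cases h1 : a.1 = Sum.inl 1
  · simp [f, h1]
  · have e1 : f a = (s.equivFin a : ℕ) + 2 := by simp [f, h0, h1]
    rw [e1, Function.update_of_ne (by omega), Function.update_of_ne (by omega)]
    have e2 : u ((s.equivFin a : ℕ) + 2) = Sum.elim w id a.1 := by simp [u]
    rw [e2]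
    rcases h : a.1 with n | m
    · have : n ≠ 0 := by rintro rfl; exact h0 h
      have : n ≠ 1 := by rintro rfl; exact h1 h
      simp [*]
    · simp

variable [ModelZF M]

theorem exists_sep (a : M) (P : M → Prop) [hP : Definable fun v => P (v 0)] :
    ∃ b : M, ∀ x, x ∈ₘ b ↔ x ∈ₘ a ∧ P x := by
  obtain ⟨φ, hφ⟩ := hP.out
  obtain ⟨ψ, u, h⟩ := exists_nat_formula φ fun _ => a
  obtain ⟨b, hb⟩ := ModelZF.separation ψ u a
  refine ⟨b, fun x => ?_⟩
  -- Separation updates only the variable `0`; a vacuous update at `1` brings it to the form of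
  -- `exists_nat_formula`.
  have : Function.update u 0 x = Function.update (Function.update u 0 x) 1 (u 1) := by
    rw [eq_comm, Function.update_eq_self_iff]; simp
  rw [hb, this, h, ← hφ]
  simp

theorem exists_image (a : M) (t : M → M) [ht : DefinableFun fun v => t (v 0)] :
    ∃ b : M, ∀ y, y ∈ₘ b ↔ ∃ x, x ∈ₘ a ∧ y = t x := by
  -- A graph has its value at `0` and its argument at `1`, while replacement expects the reverse; `1
  -- - n` swaps the two.
  obtain ⟨φ, hφ⟩ := (ht.out.rename fun n => 1 - n).out
  obtain ⟨ψ, u, h⟩ := exists_nat_formula φ fun _ => a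
  have key : ∀ x y, ψ.Realize (Function.update (Function.update u 0 x) 1 y) ↔ y = t x := by
    intro x y
    rw [h, ← hφ]
    simp
  obtain ⟨b, hb⟩ := ModelZF.replacement ψ u a fun x _ => ⟨t x, by simp [key], by simp [key]⟩
  exact ⟨b, fun y => by simp [hb, key]⟩

end Definability

/-! ## Sets, pairs and functions -/

noncomputable section SetTheory

universe u
variable {M : Type u} [setLang.Structure M] [ModelZF M]

theorem set_ext {a b : M} (h : ∀ z, z ∈ₘ a ↔ z ∈ₘ b) : a = b := ModelZF.extensionality a b h

theorem exists_isEmptySet : ∃ e : M, IsEmptySet e := by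
  obtain ⟨I, ⟨e, he, -⟩, -⟩ := ModelZF.infinity (M := M)
  exact ⟨e, he⟩

/-- The empty set. -/
def emp : M := (exists_isEmptySet (M := M)).choose

theorem notMem_emp (z : M) : ¬ z ∈ₘ emp := (exists_isEmptySet (M := M)).choose_spec z

theorem isEmptySet_iff {e : M} : IsEmptySet e ↔ e = emp :=
  ⟨fun h => set_ext fun z => iff_of_false (h z) (notMem_emp z), fun h => h ▸ notMem_emp⟩

open Classical in
/-- The unique element that satisfies `Q`, or the empty set if there is no such element. -/
def iota (Q : M → Prop) : M := if h : ∃! y, Q y then h.choose else emp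

theorem iota_eq {Q : M → Prop} {y : M} (hy : Q y) (h : ∀ z, Q z → z = y) : iota Q = y := by
  have h' : ∃! y, Q y := ⟨y, hy, h⟩
  rw [iota, dif_pos h']
  exact h _ h'.choose_spec.1

theorem iota_spec {Q : M → Prop} (h : ∃! y, Q y) : Q (iota Q) := by
  rw [iota, dif_pos h]
  exact h.choose_spec.1

/-- This makes definite descriptions usable as terms; pairs, components and function values get
their definability from it. -/
instance DefinableFun.iota {Q : (ℕ → M) → M → Prop}
    [hQ : Definable fun v => Q (fun n => v (n + 1)) (v 0)] :
    DefinableFun (fun v => iota (Q v)) := by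
  have h1 : Definable fun v => Q (fun n => v (n + 2)) (v 0) :=
    (hQ.rename (fun n => Nat.casesOn n 0 fun k => k + 2)).congr fun _ => Iff.rfl
  have h2 : Definable fun v => ∃! y, Q (fun n => v (n + 1)) y :=
    Definable.existsUnique (P := fun v y => Q (fun n => v (n + 1)) y)
  refine ⟨(inferInstance : Definable fun v => (∃! y, Q (fun n => v (n + 1)) y) ∧
    Q (fun n => v (n + 1)) (v 0) ∨ (¬ ∃! y, Q (fun n => v (n + 1)) y) ∧ v 0 = emp).congr
    fun v => ?_⟩
  by_cases h : ∃! y, Q (fun n => v (n + 1)) y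
  · simp only [h, true_and, not_true_eq_false, false_and, or_false]
    exact ⟨fun hv => (h.unique hv (iota_spec h)), fun hv => hv ▸ iota_spec h⟩
  · simp [h, ChoiceFree.iota]

open Classical in
instance DefinableFun.ite {c : (ℕ → M) → Prop} {f g : (ℕ → M) → M} [hc : Definable c]
    [hf : DefinableFun f] [hg : DefinableFun g] :
    DefinableFun (fun v => if c v then f v else g v) := by
  have h1 := hc.rename (· + 1)
  have h2 := hf.rename (· + 1)
  have h3 := hg.rename (· + 1)
  refine ⟨(inferInstance : Definable fun v => c (fun n => v (n + 1)) ∧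
    v 0 = f (fun n => v (n + 1)) ∨ ¬ c (fun n => v (n + 1)) ∧ v 0 = g (fun n => v (n + 1))).congr
    fun v => ?_⟩
  split_ifs with h <;> simp [h]

/-- The unordered pair. -/
def upair (x y : M) : M := iota fun b => IsUnorderedPair b x y

theorem isUnorderedPair_iff {b x y : M} : IsUnorderedPair b x y ↔ b = upair x y := by
  obtain ⟨c, hc⟩ := ModelZF.pairing x y
  have h : ∀ z, IsUnorderedPair z x y → z = c := fun z hz => set_ext fun w => by rw [hz, hc]
  rw [upair, iota_eq (Q := fun b => IsUnorderedPair b x y) hc h]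
  exact ⟨h b, fun e => e ▸ hc⟩

theorem mem_upair {z x y : M} : z ∈ₘ upair x y ↔ z = x ∨ z = y := isUnorderedPair_iff.2 rfl z

theorem upair_inj {a b c d : M} : upair a b = upair c d ↔ a = c ∧ b = d ∨ a = d ∧ b = c := by
  constructor
  · intro h
    have h1 : a = c ∨ a = d := mem_upair.1 (h ▸ mem_upair.2 (Or.inl rfl))
    have h2 : b = c ∨ b = d := mem_upair.1 (h ▸ mem_upair.2 (Or.inr rfl))
    have h3 : c = a ∨ c = b := mem_upair.1 (h ▸ mem_upair.2 (Or.inl rfl))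
    have h4 : d = a ∨ d = b := mem_upair.1 (h ▸ mem_upair.2 (Or.inr rfl))
    grind
  · rintro (⟨rfl, rfl⟩ | ⟨rfl, rfl⟩)
    · rfl
    · exact set_ext fun z => by rw [mem_upair, mem_upair, or_comm]

/-- The ordered pair. -/
def pair (x y : M) : M := upair (upair x x) (upair x y)

theorem isPair_iff {p x y : M} : IsPair p x y ↔ p = pair x y := by
  simp only [IsPair, isUnorderedPair_iff]
  rw [pair, ← isUnorderedPair_iff]
  rfl

theorem pair_inj {a b c d : M} : pair a b = pair c d ↔ a = c ∧ b = d := by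
  simp only [pair, upair_inj]
  grind

instance DefinableFun.pair {f g : (ℕ → M) → M} [hf : DefinableFun f] [hg : DefinableFun g] :
    DefinableFun (fun v => pair (f v) (g v)) :=
  DefinableFun.comp₂ (q := ChoiceFree.pair) (by unfold ChoiceFree.pair upair; infer_instance) hf hg

/-- The set `a ∪ {x}`. -/
def adjoin (x a : M) : M := iota fun b => IsInsert b x a

theorem isInsert_iff {b x a : M} : IsInsert b x a ↔ b = adjoin x a := by
  obtain ⟨c, hc⟩ := ModelZF.union (upair a (upair x x))
  have hc' : IsInsert c x a := fun z => by simp [hc, mem_upair]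
  have h : ∀ z, IsInsert z x a → z = c := fun z hz => set_ext fun w => by rw [hz, hc']
  rw [adjoin, iota_eq (Q := fun b => IsInsert b x a) hc' h]
  exact ⟨h b, fun e => e ▸ hc'⟩

theorem mem_adjoin {z x a : M} : z ∈ₘ adjoin x a ↔ z ∈ₘ a ∨ z = x := isInsert_iff.2 rfl z

instance DefinableFun.adjoin {f g : (ℕ → M) → M} [hf : DefinableFun f] [hg : DefinableFun g] :
    DefinableFun (fun v => adjoin (f v) (g v)) :=
  DefinableFun.comp₂ (q := ChoiceFree.adjoin) (by unfold ChoiceFree.adjoin; infer_instance) hf hg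

theorem adjoin_eq_self {x a : M} (h : x ∈ₘ a) : adjoin x a = a :=
  set_ext fun z => by rw [mem_adjoin]; exact ⟨fun h' => h'.elim id (· ▸ h), Or.inl⟩

theorem notMem_self (x : M) : ¬ x ∈ₘ x := fun h => by
  obtain ⟨y, hy, hy'⟩ := ModelZF.foundation (upair x x) ⟨x, mem_upair.2 (Or.inl rfl)⟩
  obtain rfl : y = x := by simpa using mem_upair.1 hy
  exact hy' y h hy

theorem exists_prod (a b : M) :
    ∃ c : M, ∀ z, z ∈ₘ c ↔ ∃ x y, x ∈ₘ a ∧ y ∈ₘ b ∧ z = pair x y := by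
  obtain ⟨u, hu⟩ := ModelZF.union (upair a b)
  obtain ⟨p, hp⟩ := ModelZF.powerset u
  obtain ⟨q, hq⟩ := ModelZF.powerset p
  obtain ⟨c, hc⟩ := exists_sep q fun z => ∃ x y, x ∈ₘ a ∧ y ∈ₘ b ∧ z = pair x y
  refine ⟨c, fun z => (hc z).trans ⟨And.right, fun h => ⟨?_, h⟩⟩⟩
  obtain ⟨x, y, hx, hy, rfl⟩ := h
  refine (hq _).2 fun w hw => (hp _).2 fun t ht => (hu t).2 ?_
  rcases mem_upair.1 hw with rfl | rfl
  · exact ⟨a, mem_upair.2 (Or.inl rfl), by rcases mem_upair.1 ht with rfl | rfl <;> exact hx⟩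
  · rcases mem_upair.1 ht with rfl | rfl
    · exact ⟨a, mem_upair.2 (Or.inl rfl), hx⟩
    · exact ⟨b, mem_upair.2 (Or.inr rfl), hy⟩

/-- The first component of an ordered pair. -/
def fst (p : M) : M := iota fun x => ∃ y, p = pair x y

/-- The second component of an ordered pair. -/
def snd (p : M) : M := iota fun y => ∃ x, p = pair x y

@[simp] theorem fst_pair (x y : M) : fst (pair x y) = x :=
  iota_eq ⟨y, rfl⟩ fun _ ⟨_, h⟩ => (pair_inj.1 h).1.symm

@[simp] theorem snd_pair (x y : M) : snd (pair x y) = y :=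
  iota_eq ⟨x, rfl⟩ fun _ ⟨_, h⟩ => (pair_inj.1 h).2.symm

instance DefinableFun.fst {f : (ℕ → M) → M} [hf : DefinableFun f] :
    DefinableFun (fun v => fst (f v)) :=
  DefinableFun.comp₁ (q := ChoiceFree.fst) (by unfold ChoiceFree.fst; infer_instance) hf

instance DefinableFun.snd {f : (ℕ → M) → M} [hf : DefinableFun f] :
    DefinableFun (fun v => snd (f v)) :=
  DefinableFun.comp₁ (q := ChoiceFree.snd) (by unfold ChoiceFree.snd; infer_instance) hf

/-- The value of the function `f` at `x`. -/
def app (f x : M) : M := iota fun y => pair x y ∈ₘ f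

instance DefinableFun.app {f g : (ℕ → M) → M} [hf : DefinableFun f] [hg : DefinableFun g] :
    DefinableFun (fun v => app (f v) (g v)) :=
  DefinableFun.comp₂ (q := ChoiceFree.app) (by unfold ChoiceFree.app; infer_instance) hf hg

theorem pairMem_iff {x y f : M} : PairMem x y f ↔ pair x y ∈ₘ f := by
  simp [PairMem, isPair_iff]

instance Definable.pairMem {f g h : (ℕ → M) → M} [hf : DefinableFun f]
    [hg : DefinableFun g] [hh : DefinableFun h] :
    Definable (fun v => PairMem (f v) (g v) (h v)) :=
  Definable.comp₃ (Q := PairMem) (by unfold PairMem; infer_instance) hf hg hh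

instance Definable.in {f g : (ℕ → M) → M} [hf : DefinableFun f] [hg : DefinableFun g] :
    Definable (fun v => In (f v) (g v)) :=
  Definable.mem (f := g) (g := f)

omit [ModelZF M] in
theorem Definable.isFunction {P Q : M → Prop} [hP : Definable fun v => P (v 0)]
    [hQ : Definable fun v => Q (v 0)] {f : (ℕ → M) → M} [hf : DefinableFun f] :
    Definable (fun v => IsFunction P Q (f v)) := by
  have hP' : ∀ i : ℕ, Definable fun v => P (v i) := fun i => hP.comp₁ inferInstance
  have hQ' : ∀ i : ℕ, Definable fun v => Q (v i) := fun i => hQ.comp₁ inferInstance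
  exact Definable.comp₁ (Q := IsFunction P Q) (by unfold IsFunction; infer_instance) hf

instance Definable.isFunction_in {f g h : (ℕ → M) → M} [hf : DefinableFun f]
    [hg : DefinableFun g] [hh : DefinableFun h] :
    Definable (fun v => IsFunction (In (f v)) (In (g v)) (h v)) :=
  Definable.comp₃ (Q := fun a b f => IsFunction (In a) (In b) f)
    (by unfold IsFunction; infer_instance) hf hg hh

section Functions

variable {P Q : M → Prop} {f : M}

theorem IsFunction.app_mem (hf : IsFunction P Q f) {x : M} (hx : P x) :
    Q (app f x) ∧ pair x (app f x) ∈ₘ f := by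
  obtain ⟨y, ⟨hy, hxy⟩, hu⟩ := hf.2 x hx
  rw [pairMem_iff] at hxy
  have : app f x = y := by
    refine iota_eq hxy fun z hz => hu z ⟨?_, pairMem_iff.2 hz⟩
    obtain ⟨a, b, -, hb, h⟩ := hf.1 _ hz
    rw [isPair_iff, pair_inj] at h
    exact h.2 ▸ hb
  rw [this]
  exact ⟨hy, hxy⟩

theorem IsFunction.app_eq (hf : IsFunction P Q f) {x y : M} (h : pair x y ∈ₘ f) :
    P x ∧ app f x = y := by
  obtain ⟨a, b, ha, hb, h'⟩ := hf.1 _ h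
  rw [isPair_iff, pair_inj] at h'
  obtain ⟨rfl, rfl⟩ := h'
  obtain ⟨h1, h2⟩ := hf.app_mem ha
  exact ⟨ha, (hf.2 x ha).unique ⟨h1, pairMem_iff.2 h2⟩ ⟨hb, pairMem_iff.2 h⟩⟩

/-- `Fn.apply` chooses its value outside `M`; `app` describes the same value by a formula, so it can
occur in definable statements. -/
theorem Fn.apply_val (f : Fn P Q) (x : Elt P) : (f x).1 = app f.1 x.1 :=
  (f.2.app_eq (pairMem_iff.1 (f.2.2 x.1 x.2).choose_spec.1.2)).2.symm

theorem exists_function {A : M} (hA : ∀ x, P x ↔ x ∈ₘ A) (t : M → M)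
    [DefinableFun fun v => t (v 0)] (ht : ∀ x, P x → Q (t x)) :
    ∃ f, IsFunction P Q f ∧ ∀ x, P x → app f x = t x := by
  obtain ⟨f, hf⟩ := exists_image A fun x => pair x (t x)
  have hm : ∀ x, P x → pair x (t x) ∈ₘ f := fun x hx => (hf _).2 ⟨x, (hA x).1 hx, rfl⟩
  have hfun : IsFunction P Q f := by
    refine ⟨fun p hp => ?_, fun x hx => ⟨t x, ⟨ht x hx, pairMem_iff.2 (hm x hx)⟩, ?_⟩⟩
    · obtain ⟨x, hx, rfl⟩ := (hf p).1 hp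
      exact ⟨x, t x, (hA x).2 hx, ht x ((hA x).2 hx), isPair_iff.2 rfl⟩
    · rintro y ⟨-, hy⟩
      obtain ⟨x', -, h⟩ := (hf _).1 (pairMem_iff.1 hy)
      rw [pair_inj] at h
      rw [h.2, h.1]
  exact ⟨f, hfun, fun x hx => (hfun.app_eq (hm x hx)).2⟩

theorem exists_fn {A : M} (hA : ∀ x, P x ↔ x ∈ₘ A) (t : M → M)
    [DefinableFun fun v => t (v 0)] (ht : ∀ x, P x → Q (t x)) :
    ∃ f : Fn P Q, ∀ x, (f x).1 = t x.1 := by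
  obtain ⟨f, hf, h⟩ := exists_function hA t ht
  exact ⟨⟨f, hf⟩, fun x => (Fn.apply_val _ x).trans (h x.1 x.2)⟩

end Functions

/-! ## Natural numbers and finite sets -/

theorem isNat_emp : IsNat (emp : M) := fun _ hI => by
  obtain ⟨e, he, heI⟩ := hI.1
  exact isEmptySet_iff.1 he ▸ heI

theorem IsNat.succ {n : M} (hn : IsNat n) : IsNat (adjoin n n) := fun I hI => by
  obtain ⟨s, hs, hsI⟩ := hI.2 n (hn I hI)
  exact isInsert_iff.1 hs ▸ hsI

/-- The elements of an inductive set that satisfy `P` form an inductive set. Definability of `P` is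
essential, since `M` may have nonstandard natural numbers. -/
theorem IsNat.induction {P : M → Prop} [hP : Definable fun v => P (v 0)] (h0 : P emp)
    (hs : ∀ m, P m → P (adjoin m m)) {n : M} (hn : IsNat n) : P n := by
  obtain ⟨I, hI⟩ := ModelZF.infinity (M := M)
  obtain ⟨J, hJ⟩ := exists_sep I P
  refine ((hJ n).1 (hn J ⟨⟨emp, isEmptySet_iff.2 rfl, ?_⟩, fun x hx => ?_⟩)).2
  · exact (hJ _).2 ⟨isNat_emp I hI, h0⟩
  · obtain ⟨s, hs', hsI⟩ := hI.2 x ((hJ x).1 hx).1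
    refine ⟨s, hs', (hJ s).2 ⟨hsI, ?_⟩⟩
    rw [isInsert_iff.1 hs']
    exact hs x ((hJ x).1 hx).2

/-- `f` is a bijective function from `n` to `a`. -/
def IsBijection (f n a : M) : Prop :=
  IsFunction (In n) (In a) f ∧ (∀ x y, x ∈ₘ n → y ∈ₘ n → app f x = app f y → x = y) ∧
    ∀ y, y ∈ₘ a → ∃ x, x ∈ₘ n ∧ app f x = y

theorem isFinite_iff {a : M} : IsFinite a ↔ ∃ n, IsNat n ∧ ∃ f, IsBijection f n a := by
  refine exists_congr fun n => and_congr_right fun _ => ⟨fun ⟨f, hi, hs⟩ => ⟨f.1, f.2, ?_, ?_⟩,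
    fun ⟨f, hf, hi, hs⟩ => ⟨⟨f, hf⟩, ?_, ?_⟩⟩
  · intro x y hx hy h
    have := @hi ⟨x, hx⟩ ⟨y, hy⟩ (Subtype.ext (by rw [Fn.apply_val, Fn.apply_val]; exact h))
    exact congrArg Subtype.val this
  · intro y hy
    obtain ⟨x, hx⟩ := hs ⟨y, hy⟩
    exact ⟨x.1, x.2, by rw [← Fn.apply_val, hx]⟩
  · intro x y h
    refine Subtype.ext (hi _ _ x.2 y.2 ?_)
    exact (Fn.apply_val _ x).symm.trans ((congrArg Subtype.val h).trans (Fn.apply_val _ y))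
  · rintro ⟨y, hy⟩
    obtain ⟨x, hx, hxy⟩ := hs y hy
    exact ⟨⟨x, hx⟩, Subtype.ext ((Fn.apply_val _ _).trans hxy)⟩

instance Definable.isFinite {f : (ℕ → M) → M} [hf : DefinableFun f] :
    Definable (fun v => IsFinite (f v)) :=
  Definable.comp₁ (Q := IsFinite)
    (by simp only [isFinite_iff, IsBijection]; infer_instance) hf

theorem isFinite_emp : IsFinite (emp : M) := by
  refine isFinite_iff.2 ⟨emp, isNat_emp, emp, ⟨?_, ?_⟩, ?_, ?_⟩
  all_goals simp [notMem_emp, In]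

theorem IsFinite.adjoin {a : M} (ha : IsFinite a) (x : M) : IsFinite (adjoin x a) := by
  classical
  by_cases hx : x ∈ₘ a
  · rwa [adjoin_eq_self hx]
  obtain ⟨n, hn, f, hf, hi, hs⟩ := isFinite_iff.1 ha
  have hne : ∀ {m}, m ∈ₘ n → m ≠ n := fun hm h => notMem_self n (h ▸ hm)
  obtain ⟨g, hg, hgv⟩ := exists_function (P := In (ChoiceFree.adjoin n n))
    (Q := In (ChoiceFree.adjoin x a)) (fun _ => Iff.rfl) (fun m => if m = n then x else app f m)
    (by
      intro m hm
      rcases mem_adjoin.1 hm with hm | rfl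
      · rw [if_neg (hne hm)]
        exact mem_adjoin.2 (Or.inl (hf.app_mem hm).1)
      · rw [if_pos rfl]
        exact mem_adjoin.2 (Or.inr rfl))
  have hgn : app g n = x := by rw [hgv n (mem_adjoin.2 (Or.inr rfl)), if_pos rfl]
  have hgm : ∀ {m}, m ∈ₘ n → app g m = app f m := fun hm => by
    rw [hgv _ (mem_adjoin.2 (Or.inl hm)), if_neg (hne hm)]
  have hgx : ∀ {m}, m ∈ₘ n → app g m ≠ x := fun hm h => hx (by
    rw [← h, hgm hm]; exact (hf.app_mem hm).1)
  refine isFinite_iff.2 ⟨_, hn.succ, g, hg, fun y z hy hz h => ?_, fun y hy => ?_⟩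
  · rcases mem_adjoin.1 hy with hy | rfl <;> rcases mem_adjoin.1 hz with hz | rfl
    · rw [hgm hy, hgm hz] at h
      exact hi _ _ hy hz h
    · exact absurd (h.trans hgn) (hgx hy)
    · exact absurd (h.symm.trans hgn) (hgx hz)
    · rfl
  · rcases mem_adjoin.1 hy with hy | rfl
    · obtain ⟨m, hm, rfl⟩ := hs y hy
      exact ⟨m, mem_adjoin.2 (Or.inl hm), hgm hm⟩
    · exact ⟨n, mem_adjoin.2 (Or.inr rfl), hgn⟩

/-- Enumerate `a` by `f : n → a` and use induction on `m` for the image of `m` under `f`; each step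
adjoins one value `f(m)`. -/
theorem IsFinite.induction {P : M → Prop} [hP : Definable fun v => P (v 0)] (h0 : P emp)
    (hs : ∀ F x, IsFinite F → ¬ x ∈ₘ F → P F → P (ChoiceFree.adjoin x F)) {a : M}
    (ha : IsFinite a) : P a := by
  obtain ⟨n, hn, f, hf, hi, hfs⟩ := isFinite_iff.1 ha
  have hP' : ∀ i : ℕ, Definable fun v => P (v i) := fun i => hP.comp₁ inferInstance
  have key : ∀ b, (∀ y, y ∈ₘ b ↔ ∃ x, x ∈ₘ n ∧ app f x = y) → IsFinite b ∧ P b := by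
    have : Sub n n → ∀ b, (∀ y, y ∈ₘ b ↔ ∃ x, x ∈ₘ n ∧ app f x = y) → IsFinite b ∧ P b := by
      refine IsNat.induction (P := fun m => Sub m n → ∀ b,
        (∀ y, y ∈ₘ b ↔ ∃ x, x ∈ₘ m ∧ app f x = y) → IsFinite b ∧ P b) ?_ ?_ hn
      · intro _ b hb
        obtain rfl : b = emp := set_ext fun z => by simp [hb, notMem_emp]
        exact ⟨isFinite_emp, h0⟩
      · intro m ih hm b hb
        obtain ⟨c, hc⟩ := exists_image m fun x => app f x
        obtain ⟨h1, h2⟩ := ih (fun z hz => hm z (mem_adjoin.2 (Or.inl hz))) c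
          (fun y => by rw [hc]; simp only [eq_comm])
        obtain rfl : b = ChoiceFree.adjoin (app f m) c := set_ext fun z => by
          rw [hb, mem_adjoin, hc]
          simp only [mem_adjoin]
          constructor
          · rintro ⟨x, hx | rfl, rfl⟩
            · exact Or.inl ⟨x, hx, rfl⟩
            · exact Or.inr rfl
          · rintro (⟨x, hx, rfl⟩ | rfl)
            · exact ⟨x, Or.inl hx, rfl⟩
            · exact ⟨m, Or.inr rfl, rfl⟩
        refine ⟨h1.adjoin _, ?_⟩
        by_cases hmem : app f m ∈ₘ c
        · rwa [adjoin_eq_self hmem]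
        · exact hs _ _ h1 hmem h2
    exact this fun _ h => h
  refine (key a fun y => ⟨fun hy => hfs y hy, ?_⟩).2
  rintro ⟨x, hx, rfl⟩
  exact (hf.app_mem hx).1

theorem IsFinite.subset {a b : M} (ha : IsFinite a) (hb : Sub b a) : IsFinite b := by
  refine IsFinite.induction (P := fun a => ∀ b, Sub b a → IsFinite b) ?_ ?_ ha b hb
  · intro b hb
    obtain rfl : b = emp := set_ext fun z => iff_of_false (fun h => notMem_emp z (hb z h))
      (notMem_emp z)
    exact isFinite_emp
  · intro F x _ _ ih b hb
    obtain ⟨c, hc⟩ := exists_sep b fun y => y ≠ x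
    have hcf : IsFinite c := ih c fun z hz => by
      obtain ⟨h1, h2⟩ := (hc z).1 hz
      exact (mem_adjoin.1 (hb z h1)).resolve_right h2
    by_cases hx : x ∈ₘ b
    · have : b = ChoiceFree.adjoin x c := set_ext fun z => by
        rw [mem_adjoin, hc]
        by_cases h : z = x
        · simp [h, hx]
        · simp [h]
      rw [this]
      exact hcf.adjoin x
    · have : b = c := set_ext fun z => by
        rw [hc]
        exact ⟨fun h => ⟨h, fun e => hx (e ▸ h)⟩, And.left⟩
      rwa [this]

theorem IsFinite.union {a b : M} (ha : IsFinite a) (hb : IsFinite b) :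
    ∃ c, IsFinite c ∧ ∀ z, z ∈ₘ c ↔ z ∈ₘ a ∨ z ∈ₘ b := by
  refine IsFinite.induction (P := fun b => ∃ c, IsFinite c ∧ ∀ z, z ∈ₘ c ↔ z ∈ₘ a ∨ z ∈ₘ b)
    ?_ ?_ hb
  · exact ⟨a, ha, fun z => by simp [notMem_emp]⟩
  · rintro F x - - ⟨c, hc, h⟩
    exact ⟨ChoiceFree.adjoin x c, hc.adjoin x, fun z => by rw [mem_adjoin, mem_adjoin, h, or_assoc]⟩

instance Definable.isFinSubset {f g : (ℕ → M) → M} [hf : DefinableFun f] [hg : DefinableFun g] :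
    Definable (fun v => IsFinSubset (f v) (g v)) :=
  Definable.comp₂ (Q := IsFinSubset) (by unfold IsFinSubset; infer_instance) hf hg

theorem exists_finSubsets (X : M) : ∃ P : M, ∀ F, IsFinSubset X F ↔ F ∈ₘ P := by
  obtain ⟨P, hP⟩ := ModelZF.powerset X
  obtain ⟨Q, hQ⟩ := exists_sep P IsFinite
  exact ⟨Q, fun F => by rw [hQ, hP]; rfl⟩

end SetTheory

/-! ## Chains of finite subsets of a Cohen-finite set -/

section Chains

universe u
variable {M : Type u} [setLang.Structure M] [ModelZF M]

theorem Sub.antisymm {a b : M} (h : Sub a b) (h' : Sub b a) : a = b :=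
  set_ext fun z => ⟨h z, h' z⟩

/-- Fix `A` in the chain. Induction on a finite set `F` gives a member `G` with `G ∩ F` contained in
every member; at `F = A`, the smaller of `A` and `G` is least. -/
theorem exists_least_of_chain {K : M} (hK : ∀ F, F ∈ₘ K → IsFinite F)
    (hc : ∀ F G, F ∈ₘ K → G ∈ₘ K → Sub F G ∨ Sub G F) (hne : ∃ F, F ∈ₘ K) :
    ∃ F, F ∈ₘ K ∧ ∀ G, G ∈ₘ K → Sub F G := by
  obtain ⟨A, hA⟩ := hne
  have key : ∃ G, G ∈ₘ K ∧ ∀ H, H ∈ₘ K → ∀ z, z ∈ₘ G → z ∈ₘ A → z ∈ₘ H := by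
    refine IsFinite.induction (P := fun A => ∃ G, G ∈ₘ K ∧ ∀ H, H ∈ₘ K →
      ∀ z, z ∈ₘ G → z ∈ₘ A → z ∈ₘ H) ?_ ?_ (hK A hA)
    · exact ⟨A, hA, fun _ _ z _ h => absurd h (notMem_emp z)⟩
    · rintro F x - - ⟨G, hG, h⟩
      -- If some `H` in the chain omits a point `x` of `G`, then comparability forces `H ⊆ G`, and
      -- `H` can replace `G`.
      by_cases hx : x ∈ₘ G ∧ ∃ H, H ∈ₘ K ∧ ¬ x ∈ₘ H
      · obtain ⟨hxG, H, hH, hxH⟩ := hx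
        have hHG : Sub H G := (hc H G hH hG).resolve_right fun h => hxH (h x hxG)
        refine ⟨H, hH, fun H' hH' z hz hzF => ?_⟩
        rcases mem_adjoin.1 hzF with hzF | rfl
        · exact h H' hH' z (hHG z hz) hzF
        · exact absurd hz hxH
      · push Not at hx
        refine ⟨G, hG, fun H hH z hz hzF => ?_⟩
        rcases mem_adjoin.1 hzF with hzF | rfl
        · exact h H hH z hz hzF
        · exact hx hz H hH
  obtain ⟨G, hG, h⟩ := key
  rcases hc A G hA hG with hAG | hGA
  · exact ⟨A, hA, fun H hH z hz => h H hH z (hAG z hz) hz⟩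
  · exact ⟨G, hG, fun H hH z hz => h H hH z hz (hGA z hz)⟩

theorem IsCohenFinite.exists_greatest_of_chain {X K : M} (hX : IsCohenFinite X)
    (hK : ∀ F, F ∈ₘ K → IsFinSubset X F)
    (hc : ∀ F G, F ∈ₘ K → G ∈ₘ K → Sub F G ∨ Sub G F) (hne : ∃ F, F ∈ₘ K) :
    ∃ F, F ∈ₘ K ∧ ∀ G, G ∈ₘ K → Sub G F := by
  classical
  by_contra hmax
  push Not at hmax
  obtain ⟨L, hL, hLmin⟩ := exists_least_of_chain (fun F hF => (hK F hF).2) hc hne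
  -- The immediate successor of `A` in the chain. It exists because the members strictly above `A`
  -- form a nonempty chain, which has a least element.
  let s : M → M := fun A => iota fun B => B ∈ₘ K ∧ Sub A B ∧ A ≠ B ∧
    ∀ C, C ∈ₘ K → Sub A C → A ≠ C → Sub B C
  have hs : ∀ A, A ∈ₘ K → s A ∈ₘ K ∧ Sub A (s A) ∧ A ≠ s A ∧
      ∀ C, C ∈ₘ K → Sub A C → A ≠ C → Sub (s A) C := by
    intro A hA
    obtain ⟨U, hU⟩ := exists_sep K fun B => Sub A B ∧ A ≠ B
    obtain ⟨G, hG, hGA⟩ := hmax A hA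
    obtain ⟨B, hB, hBmin⟩ := exists_least_of_chain (K := U)
      (fun F hF => (hK F ((hU F).1 hF).1).2)
      (fun F G hF hG => hc F G ((hU F).1 hF).1 ((hU G).1 hG).1)
      ⟨G, (hU G).2 ⟨hG, (hc A G hA hG).resolve_right hGA, fun h => hGA (h ▸ fun _ h => h)⟩⟩
    obtain ⟨hBK, hAB, hne⟩ := (hU B).1 hB
    have hBm : ∀ C, C ∈ₘ K → Sub A C → A ≠ C → Sub B C :=
      fun C h1 h2 h3 => hBmin C ((hU C).2 ⟨h1, h2, h3⟩)
    exact iota_spec (Q := fun B => B ∈ₘ K ∧ Sub A B ∧ A ≠ B ∧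
      ∀ C, C ∈ₘ K → Sub A C → A ≠ C → Sub B C) ⟨B, ⟨hBK, hAB, hne, hBm⟩,
        fun C ⟨h1, h2, h3, h4⟩ => (h4 B hBK hAB hne).antisymm (hBm C h1 h2 h3)⟩
  obtain ⟨FX, hFX⟩ := exists_finSubsets X
  obtain ⟨f, hval⟩ := exists_fn (P := IsFinSubset X) (Q := IsFinSubset X) hFX
    (fun A => if A ∈ₘ K then s A else A) (by
      intro A hA
      split_ifs with h
      · exact hK _ (hs A h).1
      · exact hA)
  -- If `A ⊊ B`, then `s A ⊆ B ⊊ s B`.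
  have hinj : ∀ A B, A ∈ₘ K → B ∈ₘ K → Sub A B → s A = s B → A = B := by
    intro A B hA hB hAB h
    by_contra hne
    have h1 := (hs A hA).2.2.2 B hB hAB hne
    exact (hs B hB).2.2.1 (((hs B hB).2.1).antisymm (h ▸ h1))
  have hsurj := hX f (by
    intro A B h
    have h' := congrArg Subtype.val h
    replace h' := (hval A).symm.trans (h'.trans (hval B))
    refine Subtype.ext ?_
    split_ifs at h' with hA hB hB
    · rcases hc _ _ hA hB with h1 | h1
      · exact hinj _ _ hA hB h1 h'
      · exact (hinj _ _ hB hA h1 h'.symm).symm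
    · exact absurd (h' ▸ (hs _ hA).1) hB
    · exact absurd (h'.symm ▸ (hs _ hB).1) hA
    · exact h')
  -- The least member `L` has no preimage: in the chain `A ⊊ s A = L ⊆ A` is absurd, and off the
  -- chain the map is the identity.
  obtain ⟨A, hA⟩ := hsurj ⟨L, hK L hL⟩
  have hA' := (hval A).symm.trans (congrArg Subtype.val hA)
  split_ifs at hA' with h
  · obtain ⟨h1, h2, h3, -⟩ := hs _ h
    exact h3 (h2.antisymm (hA' ▸ hLmin _ h))
  · exact h (hA' ▸ hL)

end Chains

/-! ## Real numbers and finite sums -/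

noncomputable section Reals

universe u
variable {M : Type u} [setLang.Structure M]

section DefinableReal

variable {R : M}

/-- The real-valued function `f` is definable in `M` with parameters. -/
class DefinableReal (f : (ℕ → M) → Elt (In R)) : Prop where
  out : DefinableFun fun v => (f v).1

instance DefinableReal.const (c : Elt (In R)) : DefinableReal (fun _ : ℕ → M => c) :=
  ⟨DefinableFun.const _⟩

instance DefinableReal.val {f : (ℕ → M) → Elt (In R)} [hf : DefinableReal f] :
    DefinableFun (fun v => (f v).1) := hf.out

instance DefinableReal.eq {f g : (ℕ → M) → Elt (In R)} [hf : DefinableReal f]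
    [hg : DefinableReal g] : Definable (fun v => f v = g v) :=
  (inferInstance : Definable fun v => (f v).1 = (g v).1).congr fun _ => Subtype.ext_iff.symm

variable [Field (Elt (In R))]

open Classical in
variable (R) in
/-- The element `x` of `M` as a real number, or `0` if it is not one. -/
def toR (x : M) : Elt (In R) := if h : x ∈ₘ R then ⟨x, h⟩ else 0

theorem toR_of_mem {x : M} (h : x ∈ₘ R) : toR R x = ⟨x, h⟩ := dif_pos h

@[simp] theorem toR_val (x : Elt (In R)) : toR R x.1 = x := toR_of_mem x.2

omit [Field (Elt (In R))] in
theorem DefinableReal.comp₁ {w : M → Elt (In R)} (hw : DefinableReal fun v => w (v 0))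
    {f : (ℕ → M) → M} (hf : DefinableFun f) : DefinableReal fun v => w (f v) :=
  ⟨DefinableFun.comp₁ (q := fun x => (w x).1) hw.out hf⟩

omit [Field (Elt (In R))] in
theorem DefinableReal.comp₂ {w : M → M → Elt (In R)} (hw : DefinableReal fun v => w (v 0) (v 1))
    {f g : (ℕ → M) → M} (hf : DefinableFun f) (hg : DefinableFun g) :
    DefinableReal fun v => w (f v) (g v) :=
  ⟨DefinableFun.comp₂ (q := fun x y => (w x y).1) hw.out hf hg⟩

/-- Since `toR R` maps `M` onto the reals, a quantifier over reals becomes one over `M`. -/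
instance Definable.exists_real {P : (ℕ → M) → Elt (In R) → Prop}
    [hP : Definable fun v => P (fun n => v (n + 1)) (toR R (v 0))] :
    Definable (fun v => ∃ r, P v r) :=
  (Definable.exists (P := fun v y => P v (toR R y))).congr fun _ =>
    ⟨fun ⟨_, h⟩ => ⟨_, h⟩, fun ⟨r, h⟩ => ⟨r.1, by rwa [toR_val]⟩⟩

variable [ModelZF M]

instance DefinableReal.toR {f : (ℕ → M) → M} [hf : DefinableFun f] :
    DefinableReal (fun v => toR R (f v)) := by
  classical
  refine DefinableReal.comp₁ ⟨?_⟩ hf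
  have : (fun v : ℕ → M => (ChoiceFree.toR R (v 0)).1) =
      fun v => if v 0 ∈ₘ R then v 0 else (0 : Elt (In R)).1 := by
    funext v
    unfold ChoiceFree.toR
    split_ifs <;> rfl
  rw [this]
  infer_instance

variable [LinearOrder (Elt (In R))] [IsStrictOrderedRing (Elt (In R))] [hR : Fact (IsReals R)]

omit [Field (Elt (In R))] [LinearOrder (Elt (In R))] [IsStrictOrderedRing (Elt (In R))] hR in
-- The graph of the operation is a set of `M`, hence available as a parameter of a formula.
theorem definableReal_op {o : Elt (In R) → Elt (In R) → Elt (In R)} (ho : ∃ g : M, ∀ p : M,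
    p ∈ₘ g ↔ ∃ x y : Elt (In R), ∃ q : M, IsPair q x.1 y.1 ∧ IsPair p q (o x y).1)
    {f g : (ℕ → M) → Elt (In R)} (hf : DefinableReal f) (hg : DefinableReal g) :
    DefinableReal (fun v => o (f v) (g v)) := by
  obtain ⟨G, hG⟩ := ho
  have h : ∀ (x y : Elt (In R)) (z : M), pair (pair x.1 y.1) z ∈ₘ G ↔ z = (o x y).1 := by
    intro x y z
    rw [hG]
    simp only [isPair_iff]
    constructor
    · rintro ⟨x', y', _, rfl, h⟩
      rw [pair_inj, pair_inj] at h
      obtain ⟨⟨h1, h2⟩, h3⟩ := h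
      rw [h3, Subtype.ext h1, Subtype.ext h2]
    · rintro rfl
      exact ⟨x, y, _, rfl, rfl⟩
  have : (fun v => (o (f v) (g v)).1) = fun v => iota fun z => pair (pair (f v).1 (g v).1) z ∈ₘ G := by
    funext v
    exact (iota_eq (Q := fun z => pair (pair (f v).1 (g v).1) z ∈ₘ G) ((h _ _ _).2 rfl)
      fun z hz => (h _ _ _).1 hz).symm
  refine ⟨?_⟩
  rw [this]
  have h1 := hf.out.rename (· + 1)
  have h2 := hg.out.rename (· + 1)
  infer_instance

instance DefinableReal.add {f g : (ℕ → M) → Elt (In R)} [hf : DefinableReal f]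
    [hg : DefinableReal g] : DefinableReal (fun v => f v + g v) :=
  definableReal_op hR.out.add_mem hf hg

instance DefinableReal.mul {f g : (ℕ → M) → Elt (In R)} [hf : DefinableReal f]
    [hg : DefinableReal g] : DefinableReal (fun v => f v * g v) :=
  definableReal_op hR.out.mul_mem hf hg

instance DefinableReal.sub {f g : (ℕ → M) → Elt (In R)} [hf : DefinableReal f]
    [hg : DefinableReal g] : DefinableReal (fun v => f v - g v) := by
  simp only [sub_eq_add_neg, ← neg_one_mul (g _)]
  infer_instance

instance DefinableReal.sq {f : (ℕ → M) → Elt (In R)} [hf : DefinableReal f] :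
    DefinableReal (fun v => f v ^ 2) := by
  simp only [pow_two]
  infer_instance

instance Definable.le {f g : (ℕ → M) → Elt (In R)} [hf : DefinableReal f]
    [hg : DefinableReal g] : Definable (fun v => f v ≤ g v) := by
  obtain ⟨G, hG⟩ := hR.out.le_mem
  refine (inferInstance : Definable fun v => pair (f v).1 (g v).1 ∈ₘ G).congr fun v => ?_
  rw [hG]
  simp only [isPair_iff]
  constructor
  · rintro ⟨x, y, hxy, h⟩
    rw [pair_inj] at h
    rwa [Subtype.ext h.1, Subtype.ext h.2]
  · exact fun h => ⟨_, _, h, rfl⟩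

instance Definable.lt {f g : (ℕ → M) → Elt (In R)} [hf : DefinableReal f]
    [hg : DefinableReal g] : Definable (fun v => f v < g v) := by
  simp only [← not_le]
  infer_instance

theorem exists_isLUB (Q : Elt (In R) → Prop) [hQ : Definable fun v => Q (toR R (v 0))]
    (hne : ∃ x, Q x) (hb : ∃ b, ∀ x, Q x → x ≤ b) : ∃ s, IsLUB {x | Q x} s := by
  obtain ⟨A, hA⟩ := exists_sep R fun x => Q (ChoiceFree.toR R x)
  have : {x : Elt (In R) | x.1 ∈ₘ A} = {x | Q x} := Set.ext fun x => by
    simp only [Set.mem_ofPred_eq, hA, toR_val]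
    exact ⟨And.right, fun h => ⟨x.2, h⟩⟩
  rw [← this]
  refine hR.out.complete A ?_ ?_ <;> rw [this]
  · exact hne
  · exact hb.imp fun b hb x hx => hb x hx

end DefinableReal

/-! ### Finite sums -/

section Sums

variable [ModelZF M] {R : M} [Field (Elt (In R))] {X : M}

theorem isFinSubset_emp : IsFinSubset X emp := ⟨fun z hz => absurd hz (notMem_emp z), isFinite_emp⟩

theorem IsFinSubset.adjoin {F x : M} (hF : IsFinSubset X F) (hx : x ∈ₘ X) :
    IsFinSubset X (adjoin x F) :=
  ⟨fun z hz => (mem_adjoin.1 hz).elim (hF.1 z) (· ▸ hx), hF.2.adjoin x⟩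

theorem IsFinSubset.induction {P : M → Prop} [hP : Definable fun v => P (v 0)] (h0 : P emp)
    (hs : ∀ F x, IsFinSubset X F → x ∈ₘ X → ¬ x ∈ₘ F → P F → P (ChoiceFree.adjoin x F)) {F : M}
    (hF : IsFinSubset X F) : P F := by
  refine IsFinite.induction (P := fun F => Sub F X → P F) (fun _ => h0) ?_ hF.2 hF.1
  intro F x hF hx ih h
  have hFX : Sub F X := fun z hz => h z (mem_adjoin.2 (Or.inl hz))
  exact hs F x ⟨hFX, hF⟩ (h x (mem_adjoin.2 (Or.inr rfl))) hx (ih hFX)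

theorem isFinSums_iff {w : M → Elt (In R)} {S : Fn (IsFinSubset X) (In R)} :
    IsFinSums (fun x : Elt (In X) => w x.1) S ↔ toR R (app S.1 emp) = 0 ∧
      ∀ F x, IsFinSubset X F → x ∈ₘ X → ¬ x ∈ₘ F →
        toR R (app S.1 (adjoin x F)) = toR R (app S.1 F) + w x := by
  have hv : ∀ F : Elt (IsFinSubset X), toR R (app S.1 F.1) = S F := fun F => by
    rw [← Fn.apply_val, toR_val]
  constructor
  · rintro ⟨h1, h2⟩
    refine ⟨(hv ⟨emp, isFinSubset_emp⟩).trans (h1 _ (isEmptySet_iff.2 rfl)), ?_⟩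
    intro F x hF hx hxF
    exact (hv ⟨_, hF.adjoin hx⟩).trans ((h2 ⟨F, hF⟩ ⟨_, hF.adjoin hx⟩ ⟨x, hx⟩ hxF
      (isInsert_iff.2 rfl)).trans (congrArg (· + w x) (hv ⟨F, hF⟩).symm))
  · rintro ⟨h1, h2⟩
    refine ⟨fun F hF => ?_, fun F G x hxF hG => ?_⟩
    · rw [← hv, isEmptySet_iff.1 hF, h1]
    · rw [← hv, ← hv, isInsert_iff.1 hG, h2 F.1 x.1 F.2 x.2 hxF]

variable [LinearOrder (Elt (In R))] [IsStrictOrderedRing (Elt (In R))] [hR : Fact (IsReals R)]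

/-- The sum is obtained as a least fixed point: `K` is the smallest set of pairs that contains `(∅,
0)` and is closed under `(F, s) ↦ (F ∪ {x}, s + w x)` for `x ∉ F`. That `K` is single-valued, so
that the order of summation does not matter, comes from the deletion property `hdel`. -/
theorem exists_isFinSums (X : M) (w : M → Elt (In R)) [hw : DefinableReal fun v => w (v 0)] :
    ∃ S : Fn (IsFinSubset X) (In R), IsFinSums (fun x : Elt (In X) => w x.1) S := by
  have hw' : ∀ i : ℕ, DefinableReal fun v => w (v i) := fun i => hw.comp₁ inferInstance
  let C : M → Prop := fun f => pair emp (0 : Elt (In R)).1 ∈ₘ f ∧ ∀ F s x, pair F s ∈ₘ f →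
    x ∈ₘ X → ¬ x ∈ₘ F → pair (adjoin x F) (toR R s + w x).1 ∈ₘ f
  obtain ⟨FX, hFX⟩ := exists_finSubsets X
  obtain ⟨D, hD⟩ := exists_prod FX R
  have hDp : ∀ F s, pair F s ∈ₘ D ↔ IsFinSubset X F ∧ s ∈ₘ R := by
    intro F s
    rw [hD]
    constructor
    · rintro ⟨F', s', h1, h2, h⟩
      rw [pair_inj] at h
      rw [h.1, h.2]
      exact ⟨(hFX _).2 h1, h2⟩
    · exact fun h => ⟨F, s, (hFX F).1 h.1, h.2, rfl⟩
  obtain ⟨K, hK⟩ := exists_sep D fun p => ∀ f, C f → p ∈ₘ f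
  have hKD : ∀ {F s}, pair F s ∈ₘ K → IsFinSubset X F ∧ s ∈ₘ R :=
    fun h => (hDp _ _).1 ((hK _).1 h).1
  have hK0 : pair emp (0 : Elt (In R)).1 ∈ₘ K :=
    (hK _).2 ⟨(hDp _ _).2 ⟨isFinSubset_emp, (0 : Elt (In R)).2⟩, fun f hf => hf.1⟩
  have hKs : ∀ F s x, pair F s ∈ₘ K → x ∈ₘ X → ¬ x ∈ₘ F →
      pair (adjoin x F) (toR R s + w x).1 ∈ₘ K := fun F s x h hx hxF =>
    (hK _).2 ⟨(hDp _ _).2 ⟨(hKD h).1.adjoin hx, (toR R s + w x).2⟩, fun f hf =>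
      hf.2 F s x (((hK _).1 h).2 f hf) hx hxF⟩
  have hmin : ∀ f, C f → ∀ p, p ∈ₘ K → p ∈ₘ f := fun f hf p hp => ((hK p).1 hp).2 f hf
  have hzero : ∀ s, pair emp s ∈ₘ K → s = (0 : Elt (In R)).1 := by
    obtain ⟨f, hf⟩ := exists_sep K fun p => fst p = emp → snd p = (0 : Elt (In R)).1
    intro s hs
    have := ((hf _).1 (hmin f ⟨(hf _).2 ⟨hK0, by simp⟩, fun F s x h hx hxF =>
      (hf _).2 ⟨hKs F s x ((hf _).1 h).1 hx hxF, fun h => ?_⟩⟩ _ hs)).2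
    · simpa using this
    · rw [fst_pair] at h
      exact absurd (h ▸ mem_adjoin.2 (Or.inr rfl)) (notMem_emp x)
  -- The pairs of `K` from which any point can be deleted satisfy the closure conditions, so by
  -- minimality they are all of `K`.
  have hdel : ∀ x H s, ¬ x ∈ₘ H → pair (adjoin x H) s ∈ₘ K →
      pair H (toR R s - w x).1 ∈ₘ K := by
    obtain ⟨f, hf⟩ := exists_sep K fun p => ∀ x H, ¬ x ∈ₘ H → fst p = adjoin x H →
      pair H (toR R (snd p) - w x).1 ∈ₘ K
    intro x H s hxH hs
    have := ((hf _).1 (hmin f ⟨(hf _).2 ⟨hK0, fun x H _ h => ?_⟩, fun F s y h hy hyF =>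
      (hf _).2 ⟨hKs F s y ((hf _).1 h).1 hy hyF, fun x H hxH h' => ?_⟩⟩ _ hs)).2 x H hxH
        (fst_pair _ _)
    · simpa using this
    · rw [fst_pair] at h
      exact absurd (h ▸ mem_adjoin.2 (Or.inr rfl)) (notMem_emp x)
    · rw [fst_pair] at h'
      rw [snd_pair, toR_val]
      obtain ⟨hFK, hFd⟩ := (hf _).1 h
      have hmem : ∀ z, z ∈ₘ F ∨ z = y ↔ z ∈ₘ H ∨ z = x := fun z => by
        rw [← mem_adjoin, h', mem_adjoin]
      by_cases hxy : x = y
      · subst hxy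
        have : H = F := set_ext fun z => by
          have := hmem z
          by_cases hz : z = x
          · subst hz; exact iff_of_false hxH hyF
          · simpa [hz] using this.symm
        rw [this, add_sub_cancel_right, toR_of_mem (hKD hFK).2]
        exact hFK
      -- Here `F = F' ∪ {x}` and `H = F' ∪ {y}`: delete `x` from `F`, then adjoin `y`.
      · obtain ⟨F', hF'⟩ := exists_sep F fun z => z ≠ x
        have hF : F = adjoin x F' := set_ext fun z => by
          rw [mem_adjoin, hF']
          have := (hmem x).2 (Or.inr rfl)
          by_cases hz : z = x
          · subst hz; simpa [hxy] using this
          · simp [hz]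
        have hH : H = adjoin y F' := set_ext fun z => by
          rw [mem_adjoin, hF']
          have := hmem z
          by_cases hz : z = x
          · subst hz; simp [hxH, hxy]
          · simp [hz] at this ⊢; exact this.symm
        have h1 := hFd x F' (fun h => ((hF' x).1 h).2 rfl) (by rw [fst_pair, hF])
        have h2 := hKs F' _ y h1 hy fun h => hyF ((hF' y).1 h).1
        rw [toR_val, snd_pair] at h2
        rw [hH]
        convert h2 using 3
        ring
  have huniq : ∀ F, IsFinSubset X F → ∃ s, pair F s ∈ₘ K ∧ ∀ t, pair F t ∈ₘ K → t = s := by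
    intro F hF
    refine IsFinSubset.induction (P := fun F => ∃ s, pair F s ∈ₘ K ∧ ∀ t, pair F t ∈ₘ K → t = s)
      ⟨_, hK0, hzero⟩ ?_ hF
    rintro F x - hx hxF ⟨s, hs, hu⟩
    refine ⟨_, hKs F s x hs hx hxF, fun t ht => ?_⟩
    have h1 := hu _ (hdel x F t hxF ht)
    rw [← h1, toR_val, sub_add_cancel, toR_of_mem (hKD ht).2]
  have hfun : IsFunction (IsFinSubset X) (In R) K := by
    refine ⟨fun p hp => ?_, fun F hF => ?_⟩
    · obtain ⟨F, s, hF, hs, rfl⟩ := (hD p).1 ((hK p).1 hp).1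
      exact ⟨F, s, (hFX F).2 hF, hs, isPair_iff.2 rfl⟩
    · obtain ⟨s, hs, hu⟩ := huniq F hF
      exact ⟨s, ⟨(hKD hs).2, pairMem_iff.2 hs⟩, fun t ht => hu t (pairMem_iff.1 ht.2)⟩
  refine ⟨⟨K, hfun⟩, isFinSums_iff.2 ⟨?_, fun F x hF hx hxF => ?_⟩⟩
  · rw [(hfun.app_eq hK0).2, toR_val]
  · obtain ⟨s, hs, -⟩ := huniq F hF
    rw [(hfun.app_eq hs).2, (hfun.app_eq (hKs F s x hs hx hxF)).2, toR_val]

/-- `S` is the function that sends every finite `F ⊆ X` to the sum of `w` over `F`. -/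
def IsSums (X : M) (w : M → Elt (In R)) (S : M) : Prop :=
  IsFunction (IsFinSubset X) (In R) S ∧ toR R (app S emp) = 0 ∧
    ∀ F x, IsFinSubset X F → x ∈ₘ X → ¬ x ∈ₘ F →
      toR R (app S (adjoin x F)) = toR R (app S F) + w x

omit [IsStrictOrderedRing (Elt (In R))] hR in
theorem sumLE_iff {w : M → Elt (In R)} {b : Elt (In R)} :
    SumLE (fun x : Elt (In X) => w x.1) b ↔
      ∃ S, IsSums X w S ∧ ∀ F, IsFinSubset X F → toR R (app S F) ≤ b := by
  constructor
  · rintro ⟨S, hS, hb⟩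
    refine ⟨S.1, ⟨S.2, isFinSums_iff.1 hS⟩, fun F hF => ?_⟩
    have := hb ⟨F, hF⟩
    rwa [← toR_val (S ⟨F, hF⟩), Fn.apply_val] at this
  · rintro ⟨S, ⟨hS, h⟩, hb⟩
    refine ⟨⟨S, hS⟩, isFinSums_iff.2 h, fun F => ?_⟩
    have := hb F.1 F.2
    exact (toR_val (Fn.apply _ F)).symm.trans_le ((congrArg (toR R) (Fn.apply_val _ F)).trans_le this)

theorem exists_isSums (X : M) (w : M → Elt (In R)) [hw : DefinableReal fun v => w (v 0)] :
    ∃ S, IsSums X w S := by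
  obtain ⟨S, hS⟩ := exists_isFinSums X w
  exact ⟨S.1, S.2, isFinSums_iff.1 hS⟩

omit [IsStrictOrderedRing (Elt (In R))] hR in
theorem SumLE.le {w : M → Elt (In R)} {b : Elt (In R)}
    (h : SumLE (fun x : Elt (In X) => w x.1) b) {x : M} (hx : x ∈ₘ X) : w x ≤ b := by
  obtain ⟨S, ⟨-, h0, hs⟩, hb⟩ := sumLE_iff.1 h
  have := hb _ (isFinSubset_emp.adjoin hx)
  rwa [hs emp x isFinSubset_emp hx (notMem_emp x), h0, zero_add] at this

/-- A sum is bounded if its terms are bounded by a linear combination of summable terms. -/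
theorem SumLE.of_le {w w₁ w₂ : M → Elt (In R)} [hw : DefinableReal fun v => w (v 0)]
    {b₁ b₂ c₁ c₂ : Elt (In R)} (hc₁ : 0 ≤ c₁) (hc₂ : 0 ≤ c₂)
    (h₁ : SumLE (fun x : Elt (In X) => w₁ x.1) b₁) (h₂ : SumLE (fun x : Elt (In X) => w₂ x.1) b₂)
    (h : ∀ x, x ∈ₘ X → w x ≤ c₁ * w₁ x + c₂ * w₂ x) :
    SumLE (fun x : Elt (In X) => w x.1) (c₁ * b₁ + c₂ * b₂) := by
  obtain ⟨S₁, ⟨-, hz₁, hs₁⟩, hb₁⟩ := sumLE_iff.1 h₁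
  obtain ⟨S₂, ⟨-, hz₂, hs₂⟩, hb₂⟩ := sumLE_iff.1 h₂
  obtain ⟨S, hS⟩ := exists_isSums X w
  refine sumLE_iff.2 ⟨S, hS, fun F hF => le_trans ?_ (add_le_add
    (mul_le_mul_of_nonneg_left (hb₁ F hF) hc₁) (mul_le_mul_of_nonneg_left (hb₂ F hF) hc₂))⟩
  refine IsFinSubset.induction (P := fun F => toR R (app S F) ≤
    c₁ * toR R (app S₁ F) + c₂ * toR R (app S₂ F)) ?_ ?_ hF
  · rw [hS.2.1, hz₁, hz₂]
    simp
  · intro F x hF hx hxF ih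
    rw [hS.2.2 F x hF hx hxF, hs₁ F x hF hx hxF, hs₂ F x hF hx hxF]
    linarith [h x hx]

/-- A set is finite if the sum of `w` over it is finite and `w` is bounded below on it. -/
theorem SumLE.isFinite {w : M → Elt (In R)} {b ε : Elt (In R)} (hε : 0 < ε)
    (h : SumLE (fun x : Elt (In X) => w x.1) b) {A : M} (hAX : Sub A X)
    (hA : ∀ x, x ∈ₘ A → ε ≤ w x) : IsFinite A := by
  obtain ⟨S, ⟨-, h0, hs⟩, hb⟩ := sumLE_iff.1 h
  -- Let `s` be the supremum of the finite sums over subsets of `A`. A finite `F ⊆ A` with sum above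
  -- `s - ε` must exhaust `A`, since one more point would carry the sum past `s`.
  obtain ⟨s, hs'⟩ := exists_isLUB (fun r => ∃ F, IsFinSubset A F ∧ r = toR R (app S F))
    ⟨_, emp, isFinSubset_emp, rfl⟩ ⟨b, by
      rintro _ ⟨F, hF, rfl⟩
      exact hb F ⟨fun z hz => hAX z (hF.1 z hz), hF.2⟩⟩
  have : ∃ F, IsFinSubset A F ∧ s - ε < toR R (app S F) := by
    by_contra hcon
    push Not at hcon
    have := hs'.2 (show s - ε ∈ upperBounds _ by
      rintro _ ⟨F, hF, rfl⟩
      exact hcon F hF)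
    linarith
  obtain ⟨F, hF, hlt⟩ := this
  refine hF.2.subset fun x hx => ?_
  by_contra hxF
  have h1 := hs'.1 ⟨_, hF.adjoin hx, rfl⟩
  rw [hs F x ⟨fun z hz => hAX z (hF.1 z hz), hF.2⟩ (hAX x hx) hxF] at h1
  linarith [hA x hx]

end Sums
end Reals

/-! ## Square-summable functions -/

noncomputable section SquareSummable

universe u
variable {M : Type u} [setLang.Structure M] [ModelZF M] {X R : M} [Field (Elt (In R))]

variable (R) in
/-- The real part of `ξ(x)`. -/
def re (ξ x : M) : Elt (In R) := toR R (fst (app ξ x))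

variable (R) in
/-- The imaginary part of `ξ(x)`. -/
def im (ξ x : M) : Elt (In R) := toR R (snd (app ξ x))

variable (R) in
/-- The squared absolute value of `ξ(x)`. -/
def nsq (ξ x : M) : Elt (In R) := re R ξ x ^ 2 + im R ξ x ^ 2

instance DefinableReal.re {f g : (ℕ → M) → M} [hf : DefinableFun f] [hg : DefinableFun g] :
    DefinableReal (fun v => re R (f v) (g v)) :=
  DefinableReal.comp₂ (w := ChoiceFree.re R) (by unfold ChoiceFree.re; infer_instance) hf hg

instance DefinableReal.im {f g : (ℕ → M) → M} [hf : DefinableFun f] [hg : DefinableFun g] :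
    DefinableReal (fun v => im R (f v) (g v)) :=
  DefinableReal.comp₂ (w := ChoiceFree.im R) (by unfold ChoiceFree.im; infer_instance) hf hg

theorem toCx_eq (z : Elt (IsComplex R)) : toCx z = ⟨toR R (fst z.1), toR R (snd z.1)⟩ := by
  have h := isPair_iff.1 z.2.choose_spec.choose_spec.2.2
  have h1 : fst z.1 = z.2.choose := (congrArg fst h).trans (fst_pair _ _)
  have h2 : snd z.1 = z.2.choose_spec.choose := (congrArg snd h).trans (snd_pair _ _)
  refine QuadraticAlgebra.ext ?_ ?_
  · show _ = toR R (fst z.1)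
    rw [h1, toR_of_mem z.2.choose_spec.choose_spec.1]
    rfl
  · show _ = toR R (snd z.1)
    rw [h2, toR_of_mem z.2.choose_spec.choose_spec.2.1]
    rfl

theorem CFn.val_eq (ξ : CFn X R) (x : Elt (In X)) : ξ.val x = ⟨re R ξ.1 x.1, im R ξ.1 x.1⟩ := by
  rw [CFn.val, toCx_eq, re, im, Fn.apply_val]

theorem exists_complex_set (R : M) : ∃ C, ∀ z, IsComplex R z ↔ z ∈ₘ C := by
  obtain ⟨C, hC⟩ := exists_prod R R
  refine ⟨C, fun z => ?_⟩
  simp only [hC, IsComplex, isPair_iff]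

instance Definable.isComplex {f : (ℕ → M) → M} [hf : DefinableFun f] :
    Definable (fun v => IsComplex R (f v)) :=
  Definable.comp₁ (Q := IsComplex R) (by unfold IsComplex; infer_instance) hf

variable [LinearOrder (Elt (In R))]

theorem L2.val_eq (ξ : L2 X R) (x : Elt (In X)) : ξ.val x = ⟨re R ξ.1 x.1, im R ξ.1 x.1⟩ :=
  CFn.val_eq _ x

theorem L2.absSq_val (ξ : L2 X R) (x : Elt (In X)) : absSq (ξ.val x) = nsq R ξ.1 x.1 := by
  rw [L2.val_eq]; rfl

theorem isL2_iff {ξ : M} : IsL2 X R ξ ↔ IsFunction (In X) (IsComplex R) ξ ∧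
    ∃ b : Elt (In R), SumLE (fun x : Elt (In X) => nsq R ξ x.1) b := by
  have : ∀ h : IsFunction (In X) (IsComplex R) ξ,
      (fun x : Elt (In X) => absSq (CFn.val ⟨ξ, h⟩ x)) = fun x => nsq R ξ x.1 := by
    exact fun h => funext fun x => congrArg absSq (CFn.val_eq ⟨ξ, h⟩ x)
  constructor
  · rintro ⟨h, b, hb⟩
    exact ⟨h, b, this h ▸ hb⟩
  · rintro ⟨h, b, hb⟩
    exact ⟨h, b, (this h).symm ▸ hb⟩

theorem normLE_iff {ξ : L2 X R} {r : Elt (In R)} :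
    NormLE ξ r ↔ 0 ≤ r ∧ SumLE (fun x : Elt (In X) => nsq R ξ.1 x.1) (r ^ 2) := by
  simp only [NormLE, L2.absSq_val]

theorem exists_l2_set (X R : M) [Field (Elt (In R))] [LinearOrder (Elt (In R))] :
    ∃ L, ∀ ξ, IsL2 X R ξ → ξ ∈ₘ L := by
  obtain ⟨C, hC⟩ := exists_complex_set R
  obtain ⟨D, hD⟩ := exists_prod X C
  obtain ⟨L, hL⟩ := ModelZF.powerset D
  refine ⟨L, fun ξ hξ => (hL ξ).2 fun p hp => ?_⟩
  obtain ⟨x, z, hx, hz, h⟩ := hξ.choose.1 p hp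
  exact (hD p).2 ⟨x, z, hx, (hC z).1 hz, isPair_iff.1 h⟩

variable [IsStrictOrderedRing (Elt (In R))] [hR : Fact (IsReals R)]

instance DefinableReal.nsq {f g : (ℕ → M) → M} [hf : DefinableFun f] [hg : DefinableFun g] :
    DefinableReal (fun v => nsq R (f v) (g v)) := by
  unfold ChoiceFree.nsq
  infer_instance

instance Definable.sumLE_nsq {f : (ℕ → M) → M} {g : (ℕ → M) → Elt (In R)} [hf : DefinableFun f]
    [hg : DefinableReal g] :
    Definable (fun v => SumLE (fun x : Elt (In X) => nsq R (f v) x.1) (g v)) := by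
  have : Definable fun v : ℕ → M =>
      SumLE (fun x : Elt (In X) => nsq R (v 0) x.1) (toR R (v 1)) := by
    have hS : ∀ i : ℕ, Definable fun v : ℕ → M => IsFunction (IsFinSubset X) (In R) (v i) :=
      fun i => Definable.isFunction
    simp only [sumLE_iff, IsSums]
    infer_instance
  exact (this.comp₂ (Q := fun ξ b => SumLE (fun x : Elt (In X) => nsq R ξ x.1) (toR R b)) hf
    hg.out).congr fun v => by rw [toR_val]

instance Definable.isL2 {f : (ℕ → M) → M} [hf : DefinableFun f] :
    Definable (fun v => IsL2 X R (f v)) := by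
  have hS : ∀ i : ℕ, Definable fun v : ℕ → M => IsFunction (In X) (IsComplex R) (v i) :=
    fun i => Definable.isFunction
  exact Definable.comp₁ (Q := IsL2 X R) (by simp only [isL2_iff]; infer_instance) hf

omit hR in
theorem nsq_nonneg (ξ x : M) : 0 ≤ nsq R ξ x := add_nonneg (sq_nonneg _) (sq_nonneg _)

omit [IsStrictOrderedRing (Elt (In R))] hR in
theorem exists_l2 (a b : M → Elt (In R)) [ha : DefinableReal fun v => a (v 0)]
    [hb : DefinableReal fun v => b (v 0)] {c : Elt (In R)}
    (h : SumLE (fun x : Elt (In X) => a x.1 ^ 2 + b x.1 ^ 2) c) :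
    ∃ ζ : L2 X R, ∀ x, ζ.val x = ⟨a x.1, b x.1⟩ := by
  obtain ⟨f, hf, hfv⟩ := exists_function (P := In X) (Q := IsComplex R) (fun _ => Iff.rfl)
    (fun x => pair (a x).1 (b x).1) fun x _ => ⟨_, _, (a x).2, (b x).2, isPair_iff.2 rfl⟩
  have h1 : ∀ x, x ∈ₘ X → re R f x = a x ∧ im R f x = b x := fun x hx => by
    rw [re, im, hfv x hx, fst_pair, snd_pair, toR_val, toR_val]
    exact ⟨rfl, rfl⟩
  have hL : IsL2 X R f := isL2_iff.2 ⟨hf, c, by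
    refine (congrArg (SumLE · c) (funext fun x => ?_)).mp h
    rw [nsq, (h1 x.1 x.2).1, (h1 x.1 x.2).2]⟩
  refine ⟨⟨f, hL⟩, fun x => ?_⟩
  rw [L2.val_eq]
  exact QuadraticAlgebra.ext (h1 x.1 x.2).1 (h1 x.1 x.2).2

/-- `ℓ²(X)` is closed under linear combinations. -/
theorem L2.exists_linearCombination (c d : Cx R) (ξ η : L2 X R) :
    ∃ ζ : L2 X R, ∀ x, ζ.val x = c * ξ.val x + d * η.val x := by
  obtain ⟨-, bξ, hξ⟩ := isL2_iff.1 ξ.2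
  obtain ⟨-, bη, hη⟩ := isL2_iff.1 η.2
  obtain ⟨ζ, hζ⟩ := exists_l2 (X := X)
    (fun x => (c.re * re R ξ.1 x - c.im * im R ξ.1 x) + (d.re * re R η.1 x - d.im * im R η.1 x))
    (fun x => (c.re * im R ξ.1 x + c.im * re R ξ.1 x) + (d.re * im R η.1 x + d.im * re R η.1 x))
    (SumLE.of_le (w := fun x => ((c.re * re R ξ.1 x - c.im * im R ξ.1 x) +
      (d.re * re R η.1 x - d.im * im R η.1 x)) ^ 2 + ((c.re * im R ξ.1 x + c.im * re R ξ.1 x) +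
      (d.re * im R η.1 x + d.im * re R η.1 x)) ^ 2)
      -- This is `|u + v|² ≤ 2|u|² + 2|v|²` with `u = cξ(x)` and `v = dη(x)`; the difference of the
      -- two sides is `|u - v|²`.
      (c₁ := 2 * (c.re ^ 2 + c.im ^ 2)) (c₂ := 2 * (d.re ^ 2 + d.im ^ 2))
      (by positivity) (by positivity) hξ hη fun x _ => by
        rw [nsq, nsq]
        linear_combination sq_nonneg ((c.re * re R ξ.1 x - c.im * im R ξ.1 x) -
          (d.re * re R η.1 x - d.im * im R η.1 x)) + sq_nonneg ((c.re * im R ξ.1 x +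
          c.im * re R ξ.1 x) - (d.re * im R η.1 x + d.im * re R η.1 x)))
  refine ⟨ζ, fun x => ?_⟩
  rw [hζ, L2.val_eq, L2.val_eq]
  refine QuadraticAlgebra.ext ?_ ?_
  · simp; ring
  · simp

/-! ### Finite supports over a Cohen-finite set -/

/-- An increasing family of finite subsets of a Cohen-finite set, indexed by the positive reals,
is bounded by a finite set. -/
theorem IsCohenFinite.exists_bound (hX : IsCohenFinite X) (Q : M → Elt (In R) → Prop)
    [hQ : Definable fun v => Q (v 0) (toR R (v 1))]
    (hfin : ∀ r, 0 < r → ∃ F, IsFinite F ∧ ∀ x, x ∈ₘ X → Q x r → x ∈ₘ F)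
    (hmono : ∀ x r s, 0 < r → r ≤ s → Q x r → Q x s) :
    ∃ G, IsFinSubset X G ∧ ∀ x r, x ∈ₘ X → 0 < r → Q x r → x ∈ₘ G := by
  have hQ' : ∀ i j : ℕ, Definable fun v => Q (v i) (toR R (v j)) := fun i j =>
    hQ.comp₂ (Q := fun x r => Q x (toR R r)) inferInstance inferInstance
  have hset : ∀ r, 0 < r → ∃ F, IsFinSubset X F ∧ ∀ x, x ∈ₘ F ↔ x ∈ₘ X ∧ Q x r := by
    intro r hr
    have : Definable fun v => Q (v 0) r := by
      refine (hQ.comp₂ (Q := fun x r => Q x (toR R r)) (DefinableFun.var 0)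
        (DefinableFun.const r.1)).congr fun v => by rw [toR_val]
    obtain ⟨F, hF⟩ := exists_sep X fun x => Q x r
    obtain ⟨F', hF', h⟩ := hfin r hr
    exact ⟨F, ⟨fun z hz => ((hF z).1 hz).1, hF'.subset fun z hz =>
      h z ((hF z).1 hz).1 ((hF z).1 hz).2⟩, hF⟩
  obtain ⟨FX, hFX⟩ := exists_finSubsets X
  -- `K` collects the sections `{x ∈ X : Q x r}` for `r > 0`. Monotonicity in `r` makes it a chain,
  -- and its greatest member is the bound.
  obtain ⟨K, hK⟩ := exists_sep FX fun F => ∃ r : Elt (In R), 0 < r ∧ ∀ x, x ∈ₘ F ↔ x ∈ₘ X ∧ Q x r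
  obtain ⟨G, hG, hmax⟩ := hX.exists_greatest_of_chain (K := K)
    (fun F hF => (hFX F).2 ((hK F).1 hF).1) (by
      intro F F' hF hF'
      obtain ⟨-, r, hr, h⟩ := (hK F).1 hF
      obtain ⟨-, r', hr', h'⟩ := (hK F').1 hF'
      rcases le_total r r' with hle | hle
      · exact Or.inl fun z hz => (h' z).2 ⟨((h z).1 hz).1, hmono z r r' hr hle ((h z).1 hz).2⟩
      · exact Or.inr fun z hz => (h z).2 ⟨((h' z).1 hz).1, hmono z r' r hr' hle ((h' z).1 hz).2⟩)
    (by
      obtain ⟨F, hF, h⟩ := hset 1 one_pos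
      exact ⟨F, (hK F).2 ⟨(hFX F).1 hF, 1, one_pos, h⟩⟩)
  refine ⟨G, (hFX G).2 ((hK G).1 hG).1, fun x r hx hr hxr => ?_⟩
  obtain ⟨F, hF, h⟩ := hset r hr
  exact hmax F ((hK F).2 ⟨(hFX F).1 hF, r, hr, h⟩) x ((h x).2 ⟨hx, hxr⟩)

/-- The square-summable functions on a Cohen-finite set have finite support. -/
theorem IsL2.finite_support (hX : IsCohenFinite X) {ξ : M} (hξ : IsL2 X R ξ) :
    ∃ G, IsFinSubset X G ∧ ∀ x, x ∈ₘ X → nsq R ξ x ≠ 0 → x ∈ₘ G := by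
  obtain ⟨-, b, hb⟩ := isL2_iff.1 hξ
  -- The condition says `|ξ(x)|² ≥ 1/r`. A point with `ξ(x) ≠ 0` satisfies it for `r = |ξ(x)|⁻²`.
  obtain ⟨G, hG, h⟩ := hX.exists_bound (fun x (r : Elt (In R)) => 1 ≤ r * nsq R ξ x)
    (by
      intro r hr
      obtain ⟨F, hF⟩ := exists_sep X fun x => 1 ≤ r * nsq R ξ x
      refine ⟨F, hb.isFinite (inv_pos.2 hr) (fun z hz => ((hF z).1 hz).1) fun x hx => ?_,
        fun x hx h => (hF x).2 ⟨hx, h⟩⟩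
      rw [inv_le_iff_one_le_mul₀' hr]
      exact ((hF x).1 hx).2)
    fun x r s _ hrs h => h.trans (mul_le_mul_of_nonneg_right hrs (nsq_nonneg _ _))
  refine ⟨G, hG, fun x hx hne => ?_⟩
  have hpos : 0 < nsq R ξ x := (nsq_nonneg _ _).lt_of_ne' hne
  exact h x (nsq R ξ x)⁻¹ hx (inv_pos.2 hpos) (inv_mul_cancel₀ hne).ge

theorem exists_common_support (hX : IsCohenFinite X) {C : M} (hC : IsFinite C)
    (h : ∀ η, η ∈ₘ C → IsL2 X R η) :
    ∃ G, IsFinSubset X G ∧ ∀ η x, η ∈ₘ C → x ∈ₘ X → nsq R η x ≠ 0 → x ∈ₘ G := by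
  refine IsFinite.induction (P := fun C => (∀ η, η ∈ₘ C → IsL2 X R η) →
    ∃ G, IsFinSubset X G ∧ ∀ η x, η ∈ₘ C → x ∈ₘ X → ¬ nsq R η x = 0 → x ∈ₘ G) ?_ ?_ hC h
  · exact fun _ => ⟨emp, isFinSubset_emp, fun η _ h => absurd h (notMem_emp η)⟩
  · intro F ξ _ _ ih h
    obtain ⟨G, hG, hGs⟩ := ih fun η hη => h η (mem_adjoin.2 (Or.inl hη))
    obtain ⟨G', hG', hGs'⟩ := IsL2.finite_support hX (h ξ (mem_adjoin.2 (Or.inr rfl)))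
    obtain ⟨U, hU, hUm⟩ := hG.2.union hG'.2
    refine ⟨U, ⟨fun z hz => ((hUm z).1 hz).elim (hG.1 z) (hG'.1 z), hU⟩, fun η x hη hx hne => ?_⟩
    rcases mem_adjoin.1 hη with hη | rfl
    · exact (hUm x).2 (Or.inl (hGs η x hη hx hne))
    · exact (hUm x).2 (Or.inr (hGs' x hx hne))

end SquareSummable

/-! ## Compact operators -/

section CompactOperators

universe u
variable {M : Type u} [setLang.Structure M] [ModelZF M] {X R : M} [Field (Elt (In R))]
  [LinearOrder (Elt (In R))]

theorem Fn.app_apply {P Q : M → Prop} (T : Fn P Q) (ξ : Elt P) : app T.1 ξ.1 = (T ξ).1 :=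
  (Fn.apply_val T ξ).symm

theorem L2.val_eq_zero [IsStrictOrderedRing (Elt (In R))] {ξ : L2 X R} {x : Elt (In X)} :
    ξ.val x = 0 ↔ nsq R ξ.1 x.1 = 0 := by
  rw [← L2.absSq_val, absSq]
  constructor
  · intro h
    simp [h]
  · intro h
    rw [add_eq_zero_iff_of_nonneg (sq_nonneg _) (sq_nonneg _), sq_eq_zero_iff, sq_eq_zero_iff] at h
    exact QuadraticAlgebra.ext h.1 h.2

variable [IsStrictOrderedRing (Elt (In R))]

/-- A single coordinate is bounded by the norm; this is all that the compactness argument uses of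
the distance. -/
theorem DistLT.absSq_lt {ξ η : L2 X R} {r : Elt (In R)} (h : DistLT ξ η r) (x : Elt (In X)) :
    absSq (ξ.val x - η.val x) < r ^ 2 := by
  obtain ⟨s, hs0, hsr, hs⟩ := h
  refine lt_of_le_of_lt ?_ (pow_lt_pow_left₀ hsr hs0 two_ne_zero)
  simp only [L2.val_eq] at hs ⊢
  exact hs.le (w := fun y => absSq ((⟨re R ξ.1 y, im R ξ.1 y⟩ : Cx R) - ⟨re R η.1 y, im R η.1 y⟩))
    x.2

variable [hR : Fact (IsReals R)]

/-- The vectors in the range of a compact operator on a Cohen-finite set have a common finite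
support. -/
theorem IsCompactOp.finite_support (hX : IsCohenFinite X) {T : Fn (IsL2 X R) (IsL2 X R)}
    (hT : IsCompactOp T) :
    ∃ G, IsFinSubset X G ∧ ∀ (ξ : L2 X R) x, x ∈ₘ X → nsq R (T ξ).1 x ≠ 0 → x ∈ₘ G := by
  obtain ⟨L, hL⟩ := exists_l2_set X R
  -- One parameter `r` serves both as the radius of the ball for `ξ` and, through `1/r`, as the
  -- threshold for `|(Tξ)(y)|`; raising it weakens both conditions.
  obtain ⟨G, hG, h⟩ := hX.exists_bound (fun y (r : Elt (In R)) => ∃ ξ, IsL2 X R ξ ∧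
      SumLE (fun x : Elt (In X) => nsq R ξ x.1) (r ^ 2) ∧ 1 ≤ r ^ 2 * nsq R (app T.1 ξ) y)
    (by
      intro r hr
      obtain ⟨A, hA⟩ := exists_sep L fun ξ => IsL2 X R ξ ∧
        SumLE (fun x : Elt (In X) => nsq R ξ x.1) (r ^ 2)
      obtain ⟨C, hC, hCL, hcov⟩ := hT.2 A (fun ξ hξ => ((hA ξ).1 hξ).2.1)
        ⟨r, fun ξ hξ => normLE_iff.2 ⟨hr.le, ((hA ξ.1).1 hξ).2.2⟩⟩ r⁻¹ (inv_pos.2 hr)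
      obtain ⟨F, hF, hFs⟩ := exists_common_support hX hC hCL
      refine ⟨F, hF.2, ?_⟩
      rintro y hy ⟨ξ, hξ, hξr, h1⟩
      -- Outside the common support of the centres `η(y) = 0`, so `‖Tξ - η‖ < 1/r` gives `|(Tξ)(y)|
      -- < 1/r`, against the condition on `y`.
      obtain ⟨η, hη, hd⟩ := hcov (T ⟨ξ, hξ⟩) ⟨⟨ξ, hξ⟩, (hA ξ).2 ⟨hL ξ hξ, hξ, hξr⟩, rfl⟩
      by_contra hyF
      have h0 : nsq R η.1 y = 0 := by
        by_contra h0
        exact hyF (hFs η.1 y hη hy h0)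
      have h0' : η.val ⟨y, hy⟩ = 0 := L2.val_eq_zero.2 h0
      have h2 := hd.absSq_lt ⟨y, hy⟩
      rw [h0', sub_zero, L2.absSq_val, ← Fn.app_apply] at h2
      have h3 := mul_lt_mul_of_pos_left h2 (pow_pos hr 2)
      rw [← mul_pow, mul_inv_cancel₀ hr.ne', one_pow] at h3
      exact absurd h1 (not_le.2 h3))
    (by
      rintro y r s hr hrs ⟨ξ, hξ, hξr, h1⟩
      have hrs' := pow_le_pow_left₀ hr.le hrs 2
      refine ⟨ξ, hξ, ?_, h1.trans (mul_le_mul_of_nonneg_right hrs' (nsq_nonneg _ _))⟩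
      obtain ⟨S, hS, hb⟩ := sumLE_iff.1 hξr
      exact sumLE_iff.2 ⟨S, hS, fun F hF => (hb F hF).trans hrs'⟩)
  refine ⟨G, hG, fun ξ x hx hne => ?_⟩
  obtain ⟨-, b, hb⟩ := isL2_iff.1 ξ.2
  have hpos : 0 < nsq R (T ξ).1 x := (nsq_nonneg _ _).lt_of_ne' hne
  have hb0 : 0 ≤ b := (nsq_nonneg _ _).trans (hb.le (w := fun x => nsq R ξ.1 x) hx)
  have hinv := inv_pos.2 hpos
  -- This `r` is at least `1`, so `r² ≥ r` dominates both the bound `b` for `‖ξ‖²` and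
  -- `|(Tξ)(x)|⁻²`.
  have hr : 0 < 1 + b + (nsq R (T ξ).1 x)⁻¹ := by positivity
  refine h x _ hx hr ⟨ξ.1, ξ.2, ?_, ?_⟩
  · obtain ⟨S, hS, hSb⟩ := sumLE_iff.1 hb
    exact sumLE_iff.2 ⟨S, hS, fun F hF => (hSb F hF).trans (by nlinarith)⟩
  · rw [Fn.app_apply, ← inv_le_iff_one_le_mul₀ hpos]
    nlinarith

/-! ### Linear closure and finite generation of the range -/

/-- `W` contains the zero vector and is closed under `(u, f) ↦ u + (a + b i) f`. -/
def IsLinClosed (X R W : M) [Field (Elt (In R))] [LinearOrder (Elt (In R))] : Prop :=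
  (∀ z, IsL2 X R z → (∀ x, x ∈ₘ X → nsq R z x = 0) → z ∈ₘ W) ∧
  ∀ u f v, IsL2 X R v → u ∈ₘ W → f ∈ₘ W → (∃ a b : Elt (In R), ∀ x, x ∈ₘ X →
    re R v x = re R u x + (a * re R f x - b * im R f x) ∧
    im R v x = im R u x + (a * im R f x + b * re R f x)) → v ∈ₘ W

-- The induction in `IsLinearOp.exists_generators` runs over a statement that quantifies over all
-- `W`, so linear closure must be definable. This is why it is phrased through real and imaginary
-- parts.
set_option synthInstance.maxSize 1000 in
instance Definable.isLinClosed {f : (ℕ → M) → M} [hf : DefinableFun f] :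
    Definable (fun v => IsLinClosed X R (f v)) :=
  Definable.comp₁ (Q := fun W => IsLinClosed X R W) (by unfold IsLinClosed; infer_instance) hf

theorem IsSubspace.isLinClosed {W : M} (hW : IsSubspace X R W) : IsLinClosed X R W := by
  obtain ⟨hWL, h0, hadd, hsmul⟩ := hW
  refine ⟨fun z hz h => h0 ⟨z, hz⟩ fun x => L2.val_eq_zero.2 (h x.1 x.2), ?_⟩
  rintro u f v hv hu hf ⟨a, b, h⟩
  obtain ⟨g, hg⟩ := L2.exists_linearCombination (⟨a, b⟩ : Cx R) 0 ⟨f, hWL f hf⟩ ⟨f, hWL f hf⟩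
  have hg' : IsSMul g ⟨a, b⟩ ⟨f, hWL f hf⟩ := fun x => by rw [hg, zero_mul, add_zero]
  refine hadd ⟨v, hv⟩ ⟨u, hWL u hu⟩ g (fun x => ?_) hu (hsmul g _ _ hg' hf)
  rw [hg' x, L2.val_eq, L2.val_eq, L2.val_eq]
  refine QuadraticAlgebra.ext ((h x.1 x.2).1.trans ?_) ((h x.1 x.2).2.trans ?_)
  · simp
    ring
  · simp

omit hR in
theorem IsLinClosed.mem {W : M} (hW : IsLinClosed X R W) {u f v : L2 X R} (hu : u.1 ∈ₘ W)
    (hf : f.1 ∈ₘ W) (c : Cx R) (h : ∀ x, v.val x = u.val x + c * f.val x) : v.1 ∈ₘ W := by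
  refine hW.2 u.1 f.1 v.1 v.2 hu hf ⟨c.re, c.im, fun x hx => ?_⟩
  have := h ⟨x, hx⟩
  rw [L2.val_eq, L2.val_eq, L2.val_eq, QuadraticAlgebra.ext_iff] at this
  refine ⟨this.1.trans ?_, this.2.trans ?_⟩
  · simp
    ring
  · simp

theorem IsLinearOp.exists_apply_eq {T : Fn (IsL2 X R) (IsL2 X R)} (hT : IsLinearOp T) (c : Cx R)
    (ξ η : L2 X R) : ∃ ζ, ∀ x, L2.val (T ζ) x = L2.val (T ξ) x + c * L2.val (T η) x := by
  obtain ⟨θ, hθ⟩ := L2.exists_linearCombination c 0 η η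
  obtain ⟨ζ, hζ⟩ := L2.exists_linearCombination 1 1 ξ θ
  refine ⟨ζ, fun x => ?_⟩
  rw [hT.1 ζ ξ θ (fun x => by rw [hζ, one_mul, one_mul]) x,
    hT.2 θ c η (fun x => by rw [hθ, zero_mul, add_zero]) x]

/-- The vectors in the range of `T` that are supported in a finite set are generated by finitely
many of them. -/
theorem IsLinearOp.exists_generators {T : Fn (IsL2 X R) (IsL2 X R)} (hT : IsLinearOp T) {G : M}
    (hG : IsFinSubset X G) :
    ∃ F, IsFinite F ∧ (∀ η, η ∈ₘ F → ∃ ξ : L2 X R, (T ξ).1 = η) ∧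
      ∀ W, IsLinClosed X R W → Sub F W →
        ∀ ξ : L2 X R, (∀ x, x ∈ₘ X → nsq R (T ξ).1 x ≠ 0 → x ∈ₘ G) → (T ξ).1 ∈ₘ W := by
  -- The claim is restated with `app` and elements of `M` so that the statement about `G` is
  -- definable and induction on `G` applies.
  have key : ∃ F, IsFinite F ∧ (∀ η, η ∈ₘ F → ∃ ξ, IsL2 X R ξ ∧ app T.1 ξ = η) ∧
      ∀ W, IsLinClosed X R W → Sub F W → ∀ ξ, IsL2 X R ξ →
        (∀ x, x ∈ₘ X → ¬ nsq R (app T.1 ξ) x = 0 → x ∈ₘ G) → app T.1 ξ ∈ₘ W := by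
    refine IsFinSubset.induction (P := fun G => ∃ F, IsFinite F ∧
      (∀ η, η ∈ₘ F → ∃ ξ, IsL2 X R ξ ∧ app T.1 ξ = η) ∧
      ∀ W, IsLinClosed X R W → Sub F W → ∀ ξ, IsL2 X R ξ →
        (∀ x, x ∈ₘ X → ¬ nsq R (app T.1 ξ) x = 0 → x ∈ₘ G) → app T.1 ξ ∈ₘ W) ?_ ?_ hG
    · refine ⟨emp, isFinite_emp, fun η h => absurd h (notMem_emp η), fun W hW _ ξ hξ h => ?_⟩
      refine hW.1 _ (Fn.app_apply T ⟨ξ, hξ⟩ ▸ (T ⟨ξ, hξ⟩).2) fun x hx => ?_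
      by_contra hne
      exact notMem_emp x (h x hx hne)
    · rintro H y hH hy hyH ⟨F, hF, hFT, hFW⟩
      -- Elimination at the coordinate `y`: a vector of the range supported in `H ∪ {y}` and nonzero
      -- at `y` becomes a new generator. If there is none, the old generators suffice.
      by_cases hex : ∃ η : L2 X R, nsq R (T η).1 y ≠ 0 ∧
          ∀ x, x ∈ₘ X → nsq R (T η).1 x ≠ 0 → x ∈ₘ adjoin y H
      · obtain ⟨η, hηy, hη⟩ := hex
        refine ⟨adjoin (T η).1 F, hF.adjoin _, fun θ hθ => ?_, fun W hW hFs ξ hξ h => ?_⟩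
        · rcases mem_adjoin.1 hθ with hθ | rfl
          · exact hFT θ hθ
          · exact ⟨η.1, η.2, Fn.app_apply T η⟩
        · obtain ⟨k, hk⟩ : ∃ k : Cx R, k * L2.val (T η) ⟨y, hy⟩ = L2.val (T ⟨ξ, hξ⟩) ⟨y, hy⟩ := by
            set z := L2.val (T η) ⟨y, hy⟩ with hz
            set w := L2.val (T ⟨ξ, hξ⟩) ⟨y, hy⟩
            have hn : z.re ^ 2 + z.im ^ 2 ≠ 0 := by
              have := L2.absSq_val (T η) ⟨y, hy⟩
              rw [← hz, absSq] at this
              rwa [this]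
            -- The quotient `w / z`, written as `w` times the conjugate of `z` over `|z|²`.
            refine ⟨⟨(w.re * z.re + w.im * z.im) / (z.re ^ 2 + z.im ^ 2),
              (w.im * z.re - w.re * z.im) / (z.re ^ 2 + z.im ^ 2)⟩, ?_⟩
            refine QuadraticAlgebra.ext ?_ ?_
            · simp only [QuadraticAlgebra.re_mul]
              field_simp
              ring
            · simp only [QuadraticAlgebra.im_mul]
              field_simp
              ring
          -- `Tζ = Tξ - k Tη` vanishes at `y`, so it is supported in `H` and the induction
          -- hypothesis puts it in `W`; then `Tξ = Tζ + k Tη` lies in `W` as well.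
          obtain ⟨ζ, hζ⟩ := hT.exists_apply_eq (-k) ⟨ξ, hξ⟩ η
          have hζW : (T ζ).1 ∈ₘ W := by
            have := hFW W hW (fun z hz => hFs z (mem_adjoin.2 (Or.inl hz))) ζ.1 ζ.2 fun x hx hne => by
              by_contra hxH
              rw [Fn.app_apply] at hne
              refine hne (L2.val_eq_zero (x := ⟨x, hx⟩).1 ?_)
              rw [hζ]
              by_cases hxy : x = y
              · subst hxy
                rw [neg_mul, hk, add_neg_cancel]
              · have hxa : ¬ x ∈ₘ adjoin y H := fun h' => (mem_adjoin.1 h').elim hxH hxy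
                have h1 : L2.val (T η) ⟨x, hx⟩ = 0 := by
                  by_contra h'
                  exact hxa (hη x hx fun e => h' (L2.val_eq_zero.2 e))
                have h2 : L2.val (T ⟨ξ, hξ⟩) ⟨x, hx⟩ = 0 := by
                  by_contra h'
                  refine hxa (h x hx fun e => h' (L2.val_eq_zero.2 ?_))
                  rwa [Fn.app_apply T ⟨ξ, hξ⟩] at e
                rw [h1, h2, mul_zero, add_zero]
            rwa [Fn.app_apply] at this
          rw [Fn.app_apply T ⟨ξ, hξ⟩]
          refine hW.mem hζW (hFs _ (mem_adjoin.2 (Or.inr rfl))) k fun x => ?_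
          rw [hζ]
          ring
      · refine ⟨F, hF, hFT, fun W hW hFs ξ hξ h => hFW W hW hFs ξ hξ fun x hx hne => ?_⟩
        refine (mem_adjoin.1 (h x hx hne)).resolve_right fun hxy => hex ⟨⟨ξ, hξ⟩, ?_, ?_⟩
        · rwa [← Fn.app_apply, ← hxy]
        · rwa [← Fn.app_apply]
  obtain ⟨F, hF, hFT, hFW⟩ := key
  refine ⟨F, hF, fun η hη => ?_, fun W hW hFs ξ h => ?_⟩
  · obtain ⟨ξ, hξ, h⟩ := hFT η hη
    exact ⟨⟨ξ, hξ⟩, by rw [← Fn.app_apply, h]⟩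
  · rw [← Fn.app_apply]
    refine hFW W hW hFs ξ.1 ξ.2 fun x hx hne => h x hx ?_
    rwa [← Fn.app_apply]

end CompactOperators

end ChoiceFree

theorem mainTheorem6 {M : Type*} [ChoiceFree.setLang.Structure M] [ChoiceFree.ModelZF M]
    (R : M) [Field (ChoiceFree.Elt (ChoiceFree.In R))]
    [LinearOrder (ChoiceFree.Elt (ChoiceFree.In R))]
    [IsStrictOrderedRing (ChoiceFree.Elt (ChoiceFree.In R))] (hR : ChoiceFree.IsReals R)
    (X : M) (hX : ChoiceFree.IsCF X)
    (T : ChoiceFree.Fn (ChoiceFree.IsL2 X R) (ChoiceFree.IsL2 X R))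
    (hT : ChoiceFree.IsCompactOp T) :
    ChoiceFree.HasFiniteRank T := by
  have : Fact (ChoiceFree.IsReals R) := ⟨hR⟩
  obtain ⟨G, hG, hsupp⟩ := hT.finite_support hX.2
  obtain ⟨F, hF, hFT, hFW⟩ := hT.1.exists_generators hG
  exact ⟨F, hF, hFT, fun W hW hFs ξ => hFW W hW.isLinClosed hFs ξ (hsupp ξ)⟩
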